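/- Consider an uplink network in $\mathbb R^2$ with base stations forming a homogeneous Poisson point process $\Psi$ of intensity $\lambda>0$ and devices of intensity $\mu>0$, path-loss exponent $\eta>2$, unit-mean exponential (Rayleigh) channel power gains, noise power $\sigma^2\ge 0$, decoding threshold $\theta>0$, and full channel-inversion power control: a device at distance $r$ from its serving (nearest) base station transmits with power $\rho r^\eta$, $\rho>0$. Each device has $N$ finite queues of sizes $k_1,\dots,k_N$ (a lower index means a higher priority); the vectors of queue lengths of the devices are independent copies of a random vector with an arbitrary law $\mathbb P\{(z_1,\dots,z_N)\}$ (in the network, the steady-state law). A device transmits a packet of its non-empty queue of highest priority. Class $i$ has $C_{i,m}$ dedicated channels, where, for $C$ channels in total and arrival probabilities $\alpha_j\in[0,1]$, $C_{i,\mathrm{EA}}=C/N$ (equal allocation) and $C_{i,\mathrm{WA}}=C\alpha_i/\sum_j\alpha_j$ (weighted allocation), with $C_{i,m}\ge 1$. A device selects a dedicated channel uniformly, so that any given (whole) channel is selected with probability $1/C_{i,m}$. Put $$\zeta_i=\sum_{z=1}^{k_i}\mathbb P\{(0,\dots,0,z)\},\qquad \kappa_{i,m}=\frac{\mu}{\lambda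 C_{i,m}},\qquad c=3.575,$$ where $\mathbb P\{(0,\dots,0,z)\}$ is the probability that queues $1,\dots,i-1$ are empty and queue $i$ holds $z$ packets. Let a typical device transmit a class-$i$ packet on a given one of these channels to its base station, located at $z_o$, and let $$p_i=\mathbb P\Big\{\frac{\rho h_o}{I_{\mathrm{in}}+I_{\mathrm{out}}+\sigma^2}>\theta\Big\}$$ be its coverage probability, under the following two approximations. (a) (Independent transmit powers.) The devices outside the cell of $z_o$ are the points $y_j$ of a homogeneous Poisson process of intensity $\mu$, with independent marks $R_j$ (distance to the serving base station) distributed as the distance from the origin to the nearest point of $\Psi$, for which $R_j<\|y_j-z_o\|$. Then $I_{\mathrm{out}}$ is the sum of $\rho R_j^{\eta}g_j\|y_j-z_o\|^{-\eta}$ over those of them which transmit a class-$i$ packet on the same channel. It is independent of $I_{\mathrm{in}}$. (b) (Gamma approximation of the Voronoi cell area.) The area $A$ of the cell of $z_o$ has density $(c\lambda)^c a^{c-1}e^{-c\lambda a}/\Gamma(c)$, $a>0$. Given $A$, the number of other devices in the cell is Poisson with mean $\mu A$, and $I_{\mathrm{in}}$ is the sum of $\rho g_j$ over those of them which transmit a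 class-$i$ packet on the same channel. The gains $h_o,g_j$, the queue lengths and the channel selections are independent of each other and of everything else. Then, for $m\in\{\mathrm{EA},\mathrm{WA}\}$, $$p_i=\frac{\exp\Big\{-\frac{\sigma^2\theta}{\rho}-\frac{2\theta\zeta_i\kappa_{i,m}}{\eta-2}\,{}_2F_1\big(1,1-\tfrac2\eta;2-\tfrac2\eta;-\theta\big)\Big\}}{\Big(1+\frac{\theta\zeta_i\kappa_{i,m}}{(1+\theta)c}\Big)^{c}},$$ where ${}_2F_1(a,b;u;\cdot)$ is the analytic continuation to $(-\infty,1)$ of the sum $\sum_{n\ge0}\frac{(a)_n(b)_n}{(u)_n}\frac{x^n}{n!}$, $|x|<1$. If $\eta=4$, then $$p_i=\frac{\exp\Big\{-\frac{\sigma^2\theta}{\rho}-\zeta_i\kappa_{i,m}\sqrt\theta\,\arctan\sqrt\theta\Big\}}{\Big(1+\frac{\theta\zeta_i\kappa_{i,m}}{(1+\theta)c}\Big)^{c}}.$$ -/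

import Mathlib

open MeasureTheory ProbabilityTheory
open scoped ENNReal NNReal

noncomputable section

namespace UplinkIoT

/-- The Euclidean plane. -/
abbrev Plane : Type := EuclideanSpace ℝ (Fin 2)

/-! ### The Gaussian hypergeometric function -/

/-- The Gaussian hypergeometric function `₂F₁(a, b; u; ·)` on the half-line `(-∞, 1)`: the real
analytic function there which on `(-1, 1)` is the sum of the hypergeometric series
`∑ (a)ₙ (b)ₙ zⁿ / ((u)ₙ n!)` (Mathlib's `₂F₁`, which is a junk value where the series diverges).
By the identity theorem its values on `(-∞, 1)` are determined by these two properties. -/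
def gaussHypergeometric (a b u : ℝ) : ℝ → ℝ :=
  Classical.epsilon fun F : ℝ → ℝ =>
    AnalyticOnNhd ℝ F (Set.Iio 1) ∧ ∀ z ∈ Set.Ioo (-1 : ℝ) 1, F z = ₂F₁ a b u z

/-! ### Poisson point processes -/

/-- `Ξ` is a Poisson point process (as a random counting measure) with intensity measure `Λ`. -/
structure IsPoissonProcess {Ω E : Type*} [MeasurableSpace Ω] [MeasurableSpace E]
    (P : Measure Ω) (Ξ : Ω → Measure E) (Λ : Measure E) : Prop where
  measurable : Measurable Ξ
  law_count : ∀ A : Set E, MeasurableSet A → Λ A ≠ ∞ →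
    HasLaw (fun ω => Ξ ω A)
      ((poissonMeasure (Λ A).toNNReal).map (fun n : ℕ => (n : ℝ≥0∞))) P
  indep : ∀ (n : ℕ) (A : Fin n → Set E), (∀ j, MeasurableSet (A j)) →
    Pairwise (fun j l => Disjoint (A j) (A l)) → iIndepFun (fun j ω => Ξ ω (A j)) P

/-- The distance from the origin to the nearest point of a configuration of points in the plane
(a counting measure). -/
def nearestDist (ψ : Measure Plane) : ℝ :=
  sInf {r : ℝ | 0 ≤ r ∧ ψ (Metric.closedBall 0 r) ≠ 0}

/-! ### Parameters -/

/-- The parameters of the network with `N` priority classes; class `i` has priority over class `j`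
when `i < j`. -/
structure Params (N : ℕ) where
  /-- density of the base stations -/
  bsDensity : ℝ
  /-- density of the devices -/
  devDensity : ℝ
  /-- path-loss exponent `η` -/
  η : ℝ
  /-- average power `ρ` received from a device at its serving base station -/
  ρ : ℝ
  /-- decoding threshold `θ` for the SINR -/
  θ : ℝ
  /-- square root of the noise power `σ ^ 2` -/
  σ : ℝ
  /-- total number of channels -/
  C : ℕ
  /-- sizes of the queues of a device -/
  k : Fin N → ℕ
  /-- arrival probabilities per time slot -/
  α : Fin N → ℝ

/-- The admissible parameter values. -/
structure Params.Valid {N : ℕ} (S : Params N) : Prop where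
  bsDensity_pos : 0 < S.bsDensity
  devDensity_pos : 0 < S.devDensity
  two_lt_η : 2 < S.η
  ρ_pos : 0 < S.ρ
  θ_pos : 0 < S.θ
  α_mem : ∀ j, S.α j ∈ Set.Icc (0 : ℝ) 1

/-- The two dedicated channel allocation strategies: equal and weighted allocation. -/
inductive Allocation where
  | equal
  | weighted

variable {N : ℕ} (S : Params N)

/-- The number of channels dedicated to class `i` (not necessarily an integer). -/
def Params.channels (m : Allocation) (i : Fin N) : ℝ :=
  match m with
  | .equal => S.C / N
  | .weighted => S.C * (S.α i / ∑ j, S.α j)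

/-- `κ_{i,m}`: the average number of devices per base station per channel. -/
def Params.κ (m : Allocation) (i : Fin N) : ℝ :=
  S.devDensity / (S.bsDensity * S.channels m i)

/-- The constant in the gamma approximation of the area of a planar Poisson-Voronoi cell. -/
def cellConst : ℝ := 3.575

/-! ### Queues and channel selection -/

/-- The numbers of packets in the `N` finite queues of a device. -/
abbrev Params.QueueState : Type := (j : Fin N) → Fin (S.k j + 1)

/-- The probability, under the joint law `π` of the queue lengths, that all queues of priority
higher than `i` are empty and queue `i` holds exactly `z` packets. -/
def Params.jointProb (π : Measure S.QueueState) (i : Fin N) (z : ℕ) : ℝ :=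
  π.real {q | (∀ j, j < i → (q j : ℕ) = 0) ∧ (q i : ℕ) = z}

/-- `ζ_i`, the sum of `P{(0, …, 0, z)}` over `z = 1, …, k_i`. -/
def Params.ζ (π : Measure S.QueueState) (i : Fin N) : ℝ :=
  ∑ z ∈ Finset.Icc 1 (S.k i), S.jointProb π i z

/-- Uniform channel selection among `c` dedicated channels. The whole channels
`0, …, ⌊c⌋ - 1` are selected with probability `1 / c` each; if `c` is not an integer, the remaining
fraction of a channel is labelled `⌊c⌋` and is selected with the remaining probability. -/
def channelLaw (c : ℝ) : Measure ℕ :=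
  (∑ j ∈ Finset.range ⌊c⌋₊, ENNReal.ofReal (1 / c) • Measure.dirac j)
    + ENNReal.ofReal ((c - ⌊c⌋₊) / c) • Measure.dirac ⌊c⌋₊

/-- The device-specific data which are relevant for the transmission of a class `i` packet: channel
power gain towards the considered base station, queue lengths, selected class `i` channel. -/
abbrev Params.Mark : Type := ℝ × S.QueueState × ℕ

/-- Law of the mark of a device: unit mean exponential power gain (Rayleigh fading), queue lengths
with joint law `π` and uniform channel selection, all independent. -/
def Params.markLaw (π : Measure S.QueueState) (m : Allocation) (i : Fin N) : Measure S.Mark :=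
  (expMeasure 1).prod (π.prod (channelLaw (S.channels m i)))

/-- The event that a device transmits a class `i` packet (queue `i` is not empty and all queues of
higher priority are empty) on channel `o`. -/
def Params.interferes (i : Fin N) (o : ℕ) : Set S.Mark :=
  {x | (∀ j, j < i → (x.2.1 j : ℕ) = 0) ∧ (x.2.1 i : ℕ) ≠ 0 ∧ x.2.2 = o}

/-! ### The network seen from the base station serving the typical device -/

/-- Random elements of one time slot. -/
structure Snapshot (Ω : Type*) where
  /-- channel power gain of the typical device -/
  gain : Ω → ℝ
  /-- area of the cell of the base station serving the typical device -/
  cellArea : Ω → ℝ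
  /-- number of other devices in that cell -/
  cellCount : Ω → ℕ
  /-- marks of the other devices in that cell (the first `cellCount` terms are relevant) -/
  cellMark : ℕ → Ω → S.Mark
  /-- the device process: locations, together with the distances of the devices to their own serving
  base stations and their marks -/
  devices : Ω → Measure (Plane × ℝ × S.Mark)

/-- The laws of the random elements of a time slot when an `i`-th priority packet is transmitted,
under the two approximations: the distances from the devices to their serving base stations (hence
their transmit powers) are independent of each other, each distributed according to `distLaw`, and
the area of the cell is gamma distributed. -/
structure Snapshot.IsNetwork {S : Params N} {Ω : Type*} [MeasurableSpace Ω] (X : Snapshot S Ω)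
    (P : Measure Ω) (distLaw : Measure ℝ) (π : Measure S.QueueState) (m : Allocation)
    (i : Fin N) : Prop where
  /-- Rayleigh fading of the desired signal. -/
  gain_law : HasLaw X.gain (expMeasure 1) P
  /-- The cell area `A` has the density proportional to `a ^ (c - 1) * exp (- c * bsDensity * a)`,
  which is the standard approximation of the typical Poisson-Voronoi cell (mean area
  `1 / bsDensity`). -/
  cellArea_law : HasLaw X.cellArea (gammaMeasure cellConst (cellConst * S.bsDensity)) P
  cellCount_measurable : Measurable X.cellCount
  /-- Given the area `A`, the number of devices in the cell is Poisson with mean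
  `devDensity * A`. -/
  cellCount_law : ∀ (n : ℕ) (B : Set ℝ), MeasurableSet B →
    P (X.cellArea ⁻¹' B ∩ X.cellCount ⁻¹' {n}) =
      ∫⁻ a in B, poissonMeasure (S.devDensity * a).toNNReal {n}
        ∂(gammaMeasure cellConst (cellConst * S.bsDensity))
  cellMark_law : ∀ n, HasLaw (X.cellMark n) (S.markLaw π m i) P
  cellMark_indep : iIndepFun X.cellMark P
  /-- The devices form a homogeneous Poisson point process with independent distances to the serving
  base stations and independent marks. -/
  devices_poisson : IsPoissonProcess P X.devices
    ((ENNReal.ofReal S.devDensity • (volume : Measure Plane)).prod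
      (distLaw.prod (S.markLaw π m i)))
  /-- The typical device, the cell population, its marks and the device process outside are
  mutually independent. -/
  indep_gain : IndepFun X.gain
    (fun ω => ((X.cellArea ω, X.cellCount ω), (fun n => X.cellMark n ω), X.devices ω)) P
  indep_cell : IndepFun (fun ω => (X.cellArea ω, X.cellCount ω))
    (fun ω => ((fun n => X.cellMark n ω), X.devices ω)) P
  indep_mark : IndepFun (fun ω n => X.cellMark n ω) X.devices P

/-- Transmit power under full path-loss inversion of a device at distance `r` from its serving base
station: the average received power there is `txPower r * r ^ (-η) = ρ`. -/
def Params.txPower (r : ℝ) : ℝ := S.ρ * r ^ S.η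

variable {S}

/-- Intra-cell interference: every device in the cell is received with average power `ρ`. -/
def Snapshot.intraCell {Ω : Type*} (X : Snapshot S Ω) (i : Fin N) (o : ℕ) (ω : Ω) : ℝ≥0∞ :=
  ∑ n ∈ Finset.range (X.cellCount ω),
    (S.interferes i o).indicator (fun x => ENNReal.ofReal (S.ρ * x.1)) (X.cellMark n ω)

/-- Contribution to the interference at the base station `z` of a device which is at `v.1`, has
distance `v.2.1` to its own serving base station, and has the mark `v.2.2`. The device is not in the
cell of `z` exactly if its serving base station is closer to it than `z`. -/
def Params.outContribution (S : Params N) (z : Plane) (i : Fin N) (o : ℕ)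
    (v : Plane × ℝ × S.Mark) : ℝ≥0∞ :=
  {v : Plane × ℝ × S.Mark | v.2.1 < ‖v.1 - z‖ ∧ v.2.2 ∈ S.interferes i o}.indicator
    (fun v => ENNReal.ofReal (S.txPower v.2.1 * v.2.2.1 * ‖v.1 - z‖ ^ (-S.η))) v

/-- Inter-cell interference: the sum of the contributions of all devices outside the cell. -/
def Snapshot.interCell {Ω : Type*} (X : Snapshot S Ω) (z : Plane) (i : Fin N) (o : ℕ) (ω : Ω) :
    ℝ≥0∞ :=
  ∫⁻ v, S.outContribution z i o v ∂(X.devices ω)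

/-- The signal to interference plus noise ratio of the class `i` packet of the typical device,
transmitted on channel `o` and received at the base station `z`. -/
def Snapshot.sinr {Ω : Type*} (X : Snapshot S Ω) (z : Plane) (i : Fin N) (o : ℕ) (ω : Ω) : ℝ≥0∞ :=
  ENNReal.ofReal (S.ρ * X.gain ω) /
    (X.intraCell i o ω + X.interCell z i o ω + ENNReal.ofReal (S.σ ^ 2))

/-- The coverage probability `p_i`. -/
def Snapshot.coverage {Ω : Type*} [MeasurableSpace Ω] (X : Snapshot S Ω) (P : Measure Ω)
    (z : Plane) (i : Fin N) (o : ℕ) : ℝ :=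
  P.real {ω | ENNReal.ofReal S.θ < X.sinr z i o ω}

end UplinkIoT

end

/-!
For Rayleigh fading the event of coverage is `h > θ / ρ * (I + σ ^ 2)` with a unit-mean exponential
gain `h` independent of the interference `I`, so the coverage probability is the Laplace transform
of `I + σ ^ 2` at `s = θ / ρ` (`measure_sinr_eq_lintegral`). By independence it is the product of
the factor `exp (-s σ ^ 2)` and of the Laplace transforms of the two kinds of interference.

* A device transmits a class `i` packet on the given channel with probability `p = ζ / C`. One such
  device, received with average power `a / s`, lowers the Laplace transform from `1` to
  `1 - p (1 - 1 / (1 + a))` (`lintegral_one_sub_expNeg_mark`).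
* Inside the cell `a = θ`. A Poisson number of devices with mean `μ A` gives
  `exp (-μ A p θ / (1 + θ))`, and the Laplace transform of the gamma distributed area `A` gives the
  denominator of the formula (`lintegral_expNeg_intraCell_mul`).
* Outside the cell the marked devices form a Poisson process, whose Laplace functional is
  `exp (-∫ (1 - exp (-s f)) dΛ)` (`IsPoissonProcess.lintegral_expNeg`). For a device at distance `r`
  with serving distance `R < r` one has `a = θ (R / r) ^ η`. In polar coordinates the substitution
  `r = R t ^ (-1 / η)` splits the integral over the plane into the factor `R ^ 2` and the Euler
  integral `∫₀¹ t ^ (-2 / η) / (1 + θ t) dt` (`lintegral_radialLoss`). Only the second moment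
  `E R ^ 2 = 1 / (π λ)` of the distance to the nearest base station therefore enters
  (`lintegral_nearestDist_sq`).

The Euler integral with exponent `b - 1` is analytic in its parameter `z = -θ` on `(-∞, 1)`, and
`b` times it has the hypergeometric expansion at `0`, so by the identity theorem it is the
continuation of `₂F₁(1, b; b + 1; ·)` (`gaussHypergeometric_one_eq_integral`). For `η = 4`, that is
`b = 1 / 2`, it is elementary (`integral_inv_sqrt_div_one_add_mul`).
-/

namespace UplinkIoT

open Set Filter Topology

section LaplaceFunctional

/-! ### The function `exp (-x)` on `[0, ∞]` -/

/-- The function `x ↦ exp (-x)` on `[0, ∞]`, with value `0` at `∞`. -/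
noncomputable def expNeg (x : ℝ≥0∞) : ℝ≥0∞ := EReal.exp (-(x : EReal))

lemma continuous_expNeg : Continuous expNeg :=
  ENNReal.continuous_exp.comp (continuous_neg.comp continuous_coe_ennreal_ereal)

@[fun_prop]
lemma measurable_expNeg : Measurable expNeg := continuous_expNeg.measurable

@[simp]
lemma expNeg_zero : expNeg 0 = 1 := by simp [expNeg]

@[simp]
lemma expNeg_top : expNeg ⊤ = 0 := by simp [expNeg]

lemma expNeg_ofReal {a : ℝ} (ha : 0 ≤ a) :
    expNeg (ENNReal.ofReal a) = ENNReal.ofReal (Real.exp (-a)) := by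
  rw [expNeg, EReal.coe_ennreal_ofReal, max_eq_left ha, ← EReal.coe_neg, EReal.exp_coe]

lemma expNeg_add (a b : ℝ≥0∞) : expNeg (a + b) = expNeg a * expNeg b := by
  rw [expNeg, expNeg, expNeg, EReal.coe_ennreal_add, EReal.neg_add (by simp) (by simp),
    sub_eq_add_neg, EReal.exp_add]

lemma expNeg_sum {ι : Type*} (s : Finset ι) (f : ι → ℝ≥0∞) :
    expNeg (∑ j ∈ s, f j) = ∏ j ∈ s, expNeg (f j) := by
  classical
  induction s using Finset.induction_on with
  | empty => simp
  | insert a s ha ih => rw [Finset.sum_insert ha, Finset.prod_insert ha, expNeg_add, ih]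

lemma expNeg_mul_natCast (x : ℝ≥0∞) (n : ℕ) : expNeg (x * n) = expNeg x ^ n := by
  induction n with
  | zero => simp
  | succ n ih => rw [Nat.cast_succ, mul_add, mul_one, expNeg_add, ih, pow_succ]

lemma antitone_expNeg : Antitone expNeg := fun _ _ h =>
  EReal.exp_monotone (EReal.neg_le_neg_iff.2 (EReal.coe_ennreal_le_coe_ennreal_iff.2 h))

lemma expNeg_le_one (x : ℝ≥0∞) : expNeg x ≤ 1 :=
  expNeg_zero ▸ antitone_expNeg (zero_le)

/-! ### The Laplace functional of a Poisson process -/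

/-- The probability generating function of the Poisson distribution. -/
lemma tsum_poissonMeasure_mul_pow (r : ℝ≥0) {y : ℝ≥0∞} (hy : y ≤ 1) :
    ∑' n : ℕ, poissonMeasure r {n} * y ^ n = expNeg (r * (1 - y)) := by
  lift y to ℝ≥0 using ne_top_of_le_ne_top ENNReal.one_ne_top hy
  have hy' : (y : ℝ) ≤ 1 := by exact_mod_cast hy
  have h1 : (r : ℝ≥0∞) * (1 - y) = ENNReal.ofReal (r * (1 - y)) := by
    rw [ENNReal.ofReal_mul r.coe_nonneg, ENNReal.ofReal_sub _ y.coe_nonneg]; simp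
  have hs : HasSum (fun n : ℕ => Real.exp (-r) * ((r * y : ℝ) ^ n / n.factorial))
      (Real.exp (-r) * Real.exp (r * y)) := by
    rw [Real.exp_eq_exp_ℝ]
    exact (NormedSpace.expSeries_div_hasSum_exp (r * y : ℝ)).mul_left _
  rw [h1, expNeg_ofReal (mul_nonneg r.coe_nonneg (by linarith))]
  calc ∑' n : ℕ, poissonMeasure r {n} * (y : ℝ≥0∞) ^ n
      = ∑' n : ℕ, ENNReal.ofReal (Real.exp (-r) * ((r * y : ℝ) ^ n / n.factorial)) := by
        refine tsum_congr fun n => ?_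
        rw [poissonMeasure_singleton, ← ENNReal.ofReal_coe_nnreal (p := y),
          ← ENNReal.ofReal_pow y.coe_nonneg, ← ENNReal.ofReal_mul (by positivity)]
        congr 1
        rw [mul_pow]; ring
    _ = ENNReal.ofReal (Real.exp (-r) * Real.exp (r * y)) := by
        rw [← hs.tsum_eq, ENNReal.ofReal_tsum_of_nonneg (fun n => by positivity) hs.summable]
    _ = _ := by rw [← Real.exp_add]; congr 2; ring

variable {Ω E : Type*} [MeasurableSpace Ω] [MeasurableSpace E] {P : Measure Ω}
  {Ξ : Ω → Measure E} {Λ : Measure E}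

/-- The Laplace transform of a single count; the value `x = ∞` is allowed. -/
lemma IsPoissonProcess.lintegral_expNeg_mul_count (h : IsPoissonProcess P Ξ Λ) {A : Set E}
    (hA : MeasurableSet A) (hΛ : Λ A ≠ ∞) (x : ℝ≥0∞) :
    ∫⁻ ω, expNeg (x * Ξ ω A) ∂P = expNeg (Λ A * (1 - expNeg x)) := by
  rw [(h.law_count A hA hΛ).lintegral_comp (f := fun y => expNeg (x * y)) (by fun_prop),
    lintegral_map (by fun_prop) (by fun_prop), lintegral_countable']
  simp_rw [expNeg_mul_natCast, mul_comm (expNeg x ^ _)]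
  rw [tsum_poissonMeasure_mul_pow _ (expNeg_le_one x), ENNReal.coe_toNNReal hΛ]

lemma IsPoissonProcess.lintegral_expNeg_simpleFunc (h : IsPoissonProcess P Ξ Λ)
    (f : SimpleFunc E ℝ≥0∞) (hf : ∀ x ≠ 0, Λ (f ⁻¹' {x}) ≠ ∞) :
    ∫⁻ ω, expNeg (∫⁻ v, f v ∂(Ξ ω)) ∂P = expNeg (∫⁻ v, (1 - expNeg (f v)) ∂Λ) := by
  classical
  -- The level set of `0` may have infinite measure, but it does not contribute.
  set s : Finset ℝ≥0∞ := f.range.erase 0 with hs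
  have hsum : ∀ (g : ℝ≥0∞ → ℝ≥0∞), g 0 = 0 → ∀ ν : Measure E,
      ∫⁻ v, g (f v) ∂ν = ∑ j : Fin s.card, g (s.equivFin.symm j) *
        ν (f ⁻¹' {(s.equivFin.symm j : ℝ≥0∞)}) := by
    intro g hg ν
    have h1 : ∫⁻ v, g (f v) ∂ν = ∑ x ∈ f.range, g x * ν (f ⁻¹' {x}) := by
      rw [← SimpleFunc.map_lintegral, ← SimpleFunc.lintegral_eq_lintegral]; rfl
    rw [h1, ← Finset.sum_erase f.range (a := 0) (by simp [hg]), ← hs,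
      ← Finset.sum_coe_sort s, ← s.equivFin.symm.sum_comp]
  have hmeas : ∀ x, MeasurableSet (f ⁻¹' {x}) := fun x => f.measurableSet_fiber x
  have hind := h.indep s.card (fun j => f ⁻¹' {(s.equivFin.symm j : ℝ≥0∞)}) (fun j => hmeas _)
    (fun j l hjl => Disjoint.preimage f (by
      simpa [Subtype.coe_inj] using hjl))
  have hind' := hind.comp (fun j y => expNeg ((s.equivFin.symm j : ℝ≥0∞) * y))
    (fun j => by fun_prop)
  simp_rw [hsum (fun x => x) rfl, expNeg_sum]
  have key := lintegral_prod_eq_prod_lintegral_of_indepFun Finset.univ _ hind' (fun j => by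
    have := (Measure.measurable_coe (hmeas (s.equivFin.symm j : ℝ≥0∞))).comp h.measurable
    exact measurable_expNeg.comp (measurable_const.mul this))
  refine key.trans ?_
  rw [hsum (fun x => 1 - expNeg x) (by simp), expNeg_sum]
  refine Finset.prod_congr rfl fun j _ => ?_
  have hj : (s.equivFin.symm j : ℝ≥0∞) ≠ 0 := Finset.ne_of_mem_erase (s.equivFin.symm j).2
  rw [mul_comm, ← h.lintegral_expNeg_mul_count (hmeas _) (hf _ hj)]
  rfl

/-- The Laplace functional of a Poisson process. It is computed on simple functions, where the
counts of the level sets are independent Poisson variables, and extended by monotone limits. -/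
theorem IsPoissonProcess.lintegral_expNeg [SigmaFinite Λ] [IsProbabilityMeasure P]
    (h : IsPoissonProcess P Ξ Λ) {f : E → ℝ≥0∞} (hf : Measurable f) :
    ∫⁻ ω, expNeg (∫⁻ v, f v ∂(Ξ ω)) ∂P = expNeg (∫⁻ v, (1 - expNeg (f v)) ∂Λ) := by
  -- The truncation to sets of finite measure makes the counts of all level sets Poisson.
  set F : ℕ → SimpleFunc E ℝ≥0∞ := fun n =>
    (SimpleFunc.eapprox f n).restrict (spanningSets Λ n) with hF
  have hFa : ∀ n v, F n v = (spanningSets Λ n).indicator (SimpleFunc.eapprox f n) v := fun n v =>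
    SimpleFunc.restrict_apply _ (measurableSet_spanningSets Λ n) v
  have hmono : ∀ v, Monotone fun n => F n v := by
    intro v n k hnk
    simp only [hFa]
    by_cases hv : v ∈ spanningSets Λ n
    · rw [indicator_of_mem hv, indicator_of_mem (monotone_spanningSets Λ hnk hv)]
      exact SimpleFunc.monotone_eapprox f hnk v
    · simp [indicator_of_notMem hv]
  have hlim : ∀ v, Tendsto (fun n => F n v) atTop (𝓝 (f v)) := by
    intro v
    have h1 : Tendsto (fun n => SimpleFunc.eapprox f n v) atTop (𝓝 (f v)) := by
      rw [← SimpleFunc.iSup_eapprox_apply hf v]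
      exact tendsto_atTop_iSup fun n k hnk => SimpleFunc.monotone_eapprox f hnk v
    refine h1.congr' ?_
    obtain ⟨n₀, hn₀⟩ : ∃ n, v ∈ spanningSets Λ n := by
      have : v ∈ ⋃ n, spanningSets Λ n := by rw [iUnion_spanningSets]; trivial
      exact mem_iUnion.1 this
    filter_upwards [eventually_ge_atTop n₀] with n hn
    rw [hFa, indicator_of_mem (monotone_spanningSets Λ hn hn₀)]
  have hfin : ∀ n, ∀ x ≠ 0, Λ (F n ⁻¹' {x}) ≠ ∞ := by
    intro n x hx
    refine ne_top_of_le_ne_top (measure_spanningSets_lt_top Λ n).ne (measure_mono fun v hv => ?_)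
    by_contra hcon
    rw [mem_preimage, hFa, indicator_of_notMem hcon] at hv
    exact hx hv.symm
  have hl : Tendsto (fun n => ∫⁻ ω, expNeg (∫⁻ v, F n v ∂(Ξ ω)) ∂P) atTop
      (𝓝 (∫⁻ ω, expNeg (∫⁻ v, f v ∂(Ξ ω)) ∂P)) := by
    refine tendsto_lintegral_of_dominated_convergence (fun _ => 1) (fun n => ?_)
      (fun n => ae_of_all _ fun ω => expNeg_le_one _) (by simp) (ae_of_all _ fun ω => ?_)
    · exact measurable_expNeg.comp
        ((Measure.measurable_lintegral (F n).measurable).comp h.measurable)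
    · exact (continuous_expNeg.tendsto _).comp (lintegral_tendsto_of_tendsto_of_monotone
        (fun n => (F n).measurable.aemeasurable) (ae_of_all _ hmono) (ae_of_all _ hlim))
  have hr : Tendsto (fun n => expNeg (∫⁻ v, (1 - expNeg (F n v)) ∂Λ)) atTop
      (𝓝 (expNeg (∫⁻ v, (1 - expNeg (f v)) ∂Λ))) := by
    refine (continuous_expNeg.tendsto _).comp (lintegral_tendsto_of_tendsto_of_monotone
        (fun n => ?_) (ae_of_all _ fun v n k hnk => ?_) (ae_of_all _ fun v => ?_))
    · exact (measurable_const.sub (measurable_expNeg.comp (F n).measurable)).aemeasurable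
    · exact tsub_le_tsub_left (antitone_expNeg (hmono v hnk)) 1
    · exact ENNReal.Tendsto.sub tendsto_const_nhds ((continuous_expNeg.tendsto _).comp (hlim v))
        (Or.inl ENNReal.one_ne_top)
  simp_rw [h.lintegral_expNeg_simpleFunc _ (hfin _)] at hl
  exact tendsto_nhds_unique hl hr

end LaplaceFunctional

/-! ### Gamma and exponential distributions -/

/-- The Laplace transform of the gamma distribution. -/
lemma lintegral_expNeg_gammaMeasure {a r t : ℝ} (ha : 0 < a) (hr : 0 < r) (ht : 0 ≤ t) :
    ∫⁻ x, expNeg (ENNReal.ofReal (t * x)) ∂gammaMeasure a r =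
      ENNReal.ofReal ((r / (r + t)) ^ a) := by
  have hrt : 0 < r + t := by linarith
  have hm : Measurable (gammaPDF a r) := by unfold gammaPDF; fun_prop
  have hm' : Measurable (gammaPDF a (r + t)) := by unfold gammaPDF; fun_prop
  rw [gammaMeasure, lintegral_withDensity_eq_lintegral_mul _ hm (by fun_prop)]
  -- The integrand is a multiple of the density of the gamma distribution with rate `r + t`.
  calc ∫⁻ x, (gammaPDF a r * fun x => expNeg (ENNReal.ofReal (t * x))) x
      = ∫⁻ x, ENNReal.ofReal ((r / (r + t)) ^ a) * gammaPDF a (r + t) x := by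
        refine lintegral_congr fun x => ?_
        rw [Pi.mul_apply]
        rcases lt_or_ge x 0 with hx | hx
        · rw [gammaPDF_of_neg hx, gammaPDF_of_neg hx, zero_mul, mul_zero]
        · rw [gammaPDF_of_nonneg hx, gammaPDF_of_nonneg hx, expNeg_ofReal (mul_nonneg ht hx),
            ← ENNReal.ofReal_mul (by positivity), ← ENNReal.ofReal_mul (by positivity)]
          congr 1
          rw [Real.div_rpow hr.le hrt.le, mul_assoc, ← Real.exp_add]
          have h1 : (r + t) ^ a ≠ 0 := (Real.rpow_pos_of_pos hrt a).ne'
          rw [show -(r * x) + -(t * x) = -((r + t) * x) by ring]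
          field_simp
    _ = _ := by
        rw [lintegral_const_mul _ hm', lintegral_gammaPDF_eq_one ha hrt, mul_one]

lemma lintegral_expNeg_expMeasure {t : ℝ} (ht : 0 ≤ t) :
    ∫⁻ x, expNeg (ENNReal.ofReal (t * x)) ∂expMeasure 1 = ENNReal.ofReal (1 / (1 + t)) := by
  rw [expMeasure, lintegral_expNeg_gammaMeasure one_pos one_pos ht, Real.rpow_one]

lemma isProbabilityMeasure_expMeasure_one : IsProbabilityMeasure (expMeasure 1) :=
  isProbabilityMeasure_expMeasure one_pos

lemma expMeasure_one_Ioi {x : ℝ} (hx : 0 ≤ x) :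
    expMeasure 1 (Ioi x) = ENNReal.ofReal (Real.exp (-x)) := by
  have := isProbabilityMeasure_expMeasure_one
  have h := cdf_expMeasure_eq (r := 1) one_pos x
  rw [if_pos hx, cdf_eq_real, one_mul] at h
  have h2 := probReal_compl_eq_one_sub (μ := expMeasure 1) (measurableSet_Iic (a := x))
  rw [compl_Iic, h] at h2
  rw [← ofReal_measureReal, h2]
  congr 1; ring

/-- With Rayleigh fading, the probability that the signal exceeds the threshold is exponential in
the total `D` of interference and noise. -/
lemma expMeasure_one_threshold {θ ρ : ℝ} (hθ : 0 < θ) (hρ : 0 < ρ) (D : ℝ≥0∞) :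
    expMeasure 1 {h | ENNReal.ofReal θ < ENNReal.ofReal (ρ * h) / D} =
      expNeg (ENNReal.ofReal (θ / ρ) * D) := by
  have := isProbabilityMeasure_expMeasure_one
  induction D using ENNReal.recTopCoe with
  | top => simp [hθ, hρ]
  | coe d =>
    have hset : {h : ℝ | ENNReal.ofReal θ < ENNReal.ofReal (ρ * h) / (d : ℝ≥0∞)} =
        Ioi (θ / ρ * d) := by
      ext h
      simp only [mem_ofPred_eq, mem_Ioi]
      rcases eq_or_ne d 0 with rfl | hd
      · rcases le_or_gt h 0 with hh | hh
        · have : ρ * h ≤ 0 := mul_nonpos_of_nonneg_of_nonpos hρ.le hh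
          simp [ENNReal.ofReal_of_nonpos this, hh]
        · have : ¬ ρ * h ≤ 0 := not_le.2 (mul_pos hρ hh)
          simp [ENNReal.div_zero, this, hh]
      · rw [ENNReal.lt_div_iff_mul_lt (Or.inl (by simpa using hd)) (Or.inl (by simp)),
          ← ENNReal.ofReal_coe_nnreal, ← ENNReal.ofReal_mul hθ.le,
          ENNReal.ofReal_lt_ofReal_iff_of_nonneg (by positivity), div_mul_eq_mul_div,
          div_lt_iff₀ hρ, mul_comm ρ h]
    rw [hset, expMeasure_one_Ioi (by positivity), ← ENNReal.ofReal_coe_nnreal,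
      ← ENNReal.ofReal_mul (by positivity), expNeg_ofReal (by positivity)]

section NearestDist

/-! ### The distance to the nearest base station -/

lemma nearestDist_nonneg (ψ : Measure Plane) : 0 ≤ nearestDist ψ :=
  Real.sInf_nonneg fun _ hr => hr.1

lemma measure_closedBall_eq_zero_of_lt_nearestDist {ψ : Measure Plane} {t : ℝ} (ht : 0 ≤ t)
    (h : t < nearestDist ψ) : ψ (Metric.closedBall 0 t) = 0 := by
  by_contra hcon
  exact (notMem_of_lt_csInf h ⟨0, fun _ hr => hr.1⟩) ⟨ht, hcon⟩

/-- The configuration has to be non-empty, as `nearestDist` of the empty configuration is `0`. -/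
lemma le_nearestDist {ψ : Measure Plane} {t : ℝ} (h : ψ (Metric.closedBall 0 t) = 0)
    (hne : ∃ n : ℕ, ψ (Metric.closedBall 0 n) ≠ 0) : t ≤ nearestDist ψ := by
  obtain ⟨n, hn⟩ := hne
  refine le_csInf ⟨n, Nat.cast_nonneg n, hn⟩ fun r hr => ?_
  by_contra hcon
  exact hr.2 (measure_mono_null (Metric.closedBall_subset_closedBall (not_le.1 hcon).le) h)

lemma measurable_nearestDist : Measurable nearestDist := by
  have hm : ∀ r : ℝ, MeasurableSet {ψ : Measure Plane | ψ (Metric.closedBall 0 r) = 0} := fun r =>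
    Measure.measurable_coe Metric.isClosed_closedBall.measurableSet (measurableSet_singleton 0)
  refine measurable_of_Iio fun a => ?_
  -- The second set is the empty configuration, for which `sInf ∅ = 0`.
  have : nearestDist ⁻¹' Iio a =
      (⋃ q : ℚ, {ψ | (0 : ℝ) ≤ q ∧ (q : ℝ) < a ∧ ¬ ψ (Metric.closedBall 0 (q : ℝ)) = 0}) ∪
      {ψ | 0 < a ∧ ∀ n : ℕ, ψ (Metric.closedBall 0 (n : ℝ)) = 0} := by
    ext ψ
    simp only [mem_preimage, mem_Iio, mem_union, mem_iUnion, mem_ofPred_eq]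
    constructor
    · intro h
      by_cases hne : ∃ n : ℕ, ψ (Metric.closedBall 0 (n : ℝ)) ≠ 0
      · left
        obtain ⟨q, hq1, hq2⟩ := exists_rat_btwn h
        refine ⟨q, (nearestDist_nonneg ψ).trans hq1.le, hq2, fun h0 => ?_⟩
        exact absurd (le_nearestDist h0 hne) (not_le.2 hq1)
      · right
        push Not at hne
        exact ⟨(nearestDist_nonneg ψ).trans_lt h, hne⟩
    · rintro (⟨q, hq0, hqa, hq⟩ | ⟨ha, hall⟩)
      · have hbdd : BddBelow {r : ℝ | 0 ≤ r ∧ ψ (Metric.closedBall 0 r) ≠ 0} :=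
          ⟨0, fun _ hr => hr.1⟩
        exact (csInf_le hbdd ⟨hq0, hq⟩).trans_lt hqa
      · have : {r : ℝ | 0 ≤ r ∧ ψ (Metric.closedBall 0 r) ≠ 0} = ∅ := by
          ext r
          simp only [mem_ofPred_eq, mem_empty_iff_false, iff_false, not_and, not_not]
          intro _
          obtain ⟨n, hn⟩ := exists_nat_ge r
          exact measure_mono_null (Metric.closedBall_subset_closedBall hn) (hall n)
        rw [nearestDist, this, Real.sInf_empty]
        exact ha
  rw [this]
  refine (MeasurableSet.iUnion fun q => ?_).union ?_
  · exact (MeasurableSet.const _).inter ((MeasurableSet.const _).inter (hm q).compl)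
  · refine (MeasurableSet.const _).inter ?_
    have h := MeasurableSet.iInter fun n : ℕ => hm n
    rw [← Set.ofPred_forall] at h
    exact h

variable {Ω₀ : Type*} [MeasurableSpace Ω₀] {P₀ : Measure Ω₀}
  {Ψ : Ω₀ → Measure Plane} {lam : ℝ}

lemma measure_closedBall_eq_zero (hlam : 0 < lam)
    (hΨ : IsPoissonProcess P₀ Ψ (ENNReal.ofReal lam • (volume : Measure Plane)))
    {t : ℝ} (ht : 0 ≤ t) :
    P₀ {ω | Ψ ω (Metric.closedBall 0 t) = 0} =
      ENNReal.ofReal (Real.exp (-(lam * Real.pi * t ^ 2))) := by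
  have hvol : (ENNReal.ofReal lam • (volume : Measure Plane)) (Metric.closedBall 0 t) =
      ENNReal.ofReal (lam * Real.pi * t ^ 2) := by
    rw [Measure.smul_apply, EuclideanSpace.volume_closedBall_fin_two, smul_eq_mul,
      ← ENNReal.ofReal_pow ht, ← ENNReal.ofReal_mul (by positivity),
      ← ENNReal.ofReal_mul hlam.le]
    congr 1; ring
  have hlaw := hΨ.law_count _ (Metric.isClosed_closedBall (x := (0 : Plane)) (ε := t)).measurableSet
    (by rw [hvol]; simp)
  rw [hlaw.measure_eq (p := fun y => y = 0) (measurableSet_singleton _), hvol,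
    Measure.map_apply .of_discrete (show MeasurableSet {x : ℝ≥0∞ | x = 0} from
      measurableSet_singleton _)]
  have : (fun n : ℕ => (n : ℝ≥0∞)) ⁻¹' {x | x = 0} = {0} := by ext n; simp
  rw [this, poissonMeasure_singleton]
  have h0 : 0 ≤ lam * Real.pi * t ^ 2 := by positivity
  simp [ENNReal.coe_toNNReal_eq_toReal, ENNReal.toReal_ofReal h0]

lemma ae_exists_measure_closedBall_ne_zero (hlam : 0 < lam)
    (hΨ : IsPoissonProcess P₀ Ψ (ENNReal.ofReal lam • (volume : Measure Plane))) :
    ∀ᵐ ω ∂P₀, ∃ n : ℕ, Ψ ω (Metric.closedBall 0 n) ≠ 0 := by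
  rw [ae_iff]
  have hle : ∀ n : ℕ, P₀ {ω | ¬ ∃ n : ℕ, Ψ ω (Metric.closedBall 0 n) ≠ 0} ≤
      ENNReal.ofReal (Real.exp (-(lam * Real.pi * (n : ℝ) ^ 2))) := fun n => by
    rw [← measure_closedBall_eq_zero hlam hΨ n.cast_nonneg]
    refine measure_mono fun ω hω => ?_
    simp only [mem_ofPred_eq, not_exists, not_not] at hω
    exact hω n
  have hlim : Tendsto (fun n : ℕ => ENNReal.ofReal (Real.exp (-(lam * Real.pi * (n : ℝ) ^ 2))))
      atTop (𝓝 0) := by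
    rw [← ENNReal.ofReal_zero]
    refine (ENNReal.continuous_ofReal.tendsto _).comp (Real.tendsto_exp_neg_atTop_nhds_zero.comp ?_)
    exact ((tendsto_pow_atTop two_ne_zero).comp tendsto_natCast_atTop_atTop).const_mul_atTop
      (by positivity)
  exact le_antisymm (ge_of_tendsto' hlim hle) (zero_le)

/-- The second moment of the distance to the nearest base station. -/
lemma lintegral_nearestDist_sq (hlam : 0 < lam)
    (hΨ : IsPoissonProcess P₀ Ψ (ENNReal.ofReal lam • (volume : Measure Plane))) :
    ∫⁻ ω, ENNReal.ofReal (nearestDist (Ψ ω) ^ 2) ∂P₀ = ENNReal.ofReal (1 / (Real.pi * lam)) := by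
  have hm : AEMeasurable (fun ω => nearestDist (Ψ ω)) P₀ :=
    (measurable_nearestDist.comp hΨ.measurable).aemeasurable
  have h0 : 0 ≤ᵐ[P₀] fun ω => nearestDist (Ψ ω) := ae_of_all _ fun ω => nearestDist_nonneg _
  have hlt := lintegral_rpow_eq_lintegral_meas_lt_mul P₀ h0 hm (p := 2) two_pos
  have hle := lintegral_rpow_eq_lintegral_meas_le_mul P₀ h0 hm (p := 2) two_pos
  have hval : ENNReal.ofReal 2 * ∫⁻ t in Ioi (0 : ℝ),
      ENNReal.ofReal (Real.exp (-(lam * Real.pi * t ^ 2))) * ENNReal.ofReal (t ^ ((2 : ℝ) - 1)) =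
      ENNReal.ofReal (1 / (Real.pi * lam)) := by
    have hb : 0 < lam * Real.pi := by positivity
    have hI := integral_rpow_mul_exp_neg_mul_rpow (p := 2) (q := 1) (b := lam * Real.pi)
      two_pos (by norm_num) hb
    have hint := integrableOn_rpow_mul_exp_neg_mul_rpow (p := 2) (s := 1) (b := lam * Real.pi)
      (by norm_num) (by norm_num) hb
    have : ∫⁻ t in Ioi (0 : ℝ), ENNReal.ofReal (Real.exp (-(lam * Real.pi * t ^ 2))) *
        ENNReal.ofReal (t ^ ((2 : ℝ) - 1)) = ENNReal.ofReal (1 / (2 * (lam * Real.pi))) := by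
      calc _ = ∫⁻ t in Ioi (0 : ℝ),
            ENNReal.ofReal (t ^ (1 : ℝ) * Real.exp (-(lam * Real.pi) * t ^ (2 : ℝ))) := by
            refine setLIntegral_congr_fun measurableSet_Ioi fun t ht => ?_
            rw [← ENNReal.ofReal_mul (Real.exp_nonneg _), mul_comm, Real.rpow_two]
            norm_num
        _ = ENNReal.ofReal (∫ t in Ioi (0 : ℝ),
            t ^ (1 : ℝ) * Real.exp (-(lam * Real.pi) * t ^ (2 : ℝ))) := by
            rw [ofReal_integral_eq_lintegral_ofReal hint]
            refine (ae_restrict_iff' measurableSet_Ioi).2 (ae_of_all _ fun t ht => ?_)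
            exact mul_nonneg (Real.rpow_nonneg (le_of_lt ht) _) (Real.exp_nonneg _)
        _ = _ := by
            rw [hI]
            congr 1
            norm_num [Real.rpow_neg_one]
    rw [this, ← ENNReal.ofReal_mul (by norm_num)]
    congr 1
    field_simp
  simp_rw [Real.rpow_two] at hlt hle
  -- `{t < R} ⊆ {no point within t} ⊆ {t ≤ R}` almost surely, and the layer cake formula holds both
  -- with `<` and with `≤`.
  refine le_antisymm ?_ ?_
  · rw [hlt, ← hval]
    gcongr _ * ?_
    refine setLIntegral_mono' measurableSet_Ioi fun t ht => ?_
    rw [← measure_closedBall_eq_zero hlam hΨ (le_of_lt ht)]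
    gcongr
    exact fun h => measure_closedBall_eq_zero_of_lt_nearestDist (le_of_lt ht) h
  · rw [hle, ← hval]
    gcongr _ * ?_
    refine setLIntegral_mono' measurableSet_Ioi fun t ht => ?_
    rw [← measure_closedBall_eq_zero hlam hΨ (le_of_lt ht)]
    gcongr ?_ * _
    refine measure_mono_ae ?_
    filter_upwards [ae_exists_measure_closedBall_ne_zero hlam hΨ] with ω hω h
    exact le_nearestDist h hω

end NearestDist

/-! ### Euler's integral for the hypergeometric function -/

lemma min_le_one_sub_mul {z t : ℝ} (ht : t ∈ Ioo (0 : ℝ) 1) :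
    min 1 (1 - z) ≤ 1 - z * t := by
  rcases le_total z 0 with h | h
  · exact (min_le_left _ _).trans (by nlinarith [ht.1])
  · exact (min_le_right _ _).trans (by nlinarith [ht.2])

lemma integrableOn_rpow_sub_one {b : ℝ} (hb : 0 < b) :
    IntegrableOn (fun t : ℝ => t ^ (b - 1)) (Ioo 0 1) := by
  have h := (intervalIntegral.intervalIntegrable_rpow' (a := 0) (b := 1)
    (show -1 < b - 1 by linarith))
  rw [intervalIntegrable_iff_integrableOn_Ioo_of_le zero_le_one] at h
  exact h

/-- Expansion of Euler's integral around a point `z₀ < 1`, from the geometric series. At `z₀ = 0` it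
is the hypergeometric series; at the other points it gives analyticity. -/
lemma hasSum_eulerIntegral {b : ℝ} (hb : 0 < b) {z₀ z : ℝ} (hz₀ : z₀ < 1)
    (hz : |z| < min 1 (1 - z₀)) :
    HasSum (fun n : ℕ => z ^ n *
        ∫ t in Ioo (0 : ℝ) 1, t ^ (b - 1) * (t ^ n / (1 - z₀ * t) ^ (n + 1)))
      (∫ t in Ioo (0 : ℝ) 1, t ^ (b - 1) / (1 - (z₀ + z) * t)) := by
  set M := min 1 (1 - z₀) with hM
  have hM0 : 0 < M := lt_min one_pos (by linarith)
  have hq0 : 0 ≤ |z| / M := by positivity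
  have hq1 : |z| / M < 1 := (div_lt_one hM0).2 hz
  simp_rw [← integral_const_mul]
  refine hasSum_integral_of_dominated_convergence
    (fun n t => t ^ (b - 1) * (1 / M) * (|z| / M) ^ n) (fun n => ?_) (fun n => ?_) ?_ ?_ ?_
  · exact Measurable.aestronglyMeasurable (by fun_prop)
  · refine (ae_restrict_iff' measurableSet_Ioo).2 (ae_of_all _ fun t ht => ?_)
    have h1 := min_le_one_sub_mul (z := z₀) ht
    have h2 : 0 < 1 - z₀ * t := hM0.trans_le h1
    have h3 : 0 ≤ t ^ (b - 1) := Real.rpow_nonneg ht.1.le _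
    rw [Real.norm_eq_abs, abs_mul, abs_mul, abs_pow, abs_of_nonneg h3,
      abs_of_nonneg (div_nonneg (pow_nonneg ht.1.le n) (pow_nonneg h2.le _)),
      div_pow, mul_left_comm, mul_assoc (t ^ (b - 1))]
    refine mul_le_mul_of_nonneg_left ?_ h3
    rw [show 1 / M * (|z| ^ n / M ^ n) = |z| ^ n * (1 / M ^ (n + 1)) by
      rw [pow_succ]; field_simp]
    refine mul_le_mul_of_nonneg_left ?_ (by positivity)
    exact div_le_div₀ zero_le_one (pow_le_one₀ ht.1.le ht.2.le) (by positivity)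
      (pow_le_pow_left₀ hM0.le h1 _)
  · exact ae_of_all _ fun t => (summable_geometric_of_lt_one hq0 hq1).mul_left _
  · simp_rw [tsum_mul_left]
    exact ((integrableOn_rpow_sub_one hb).mul_const _).mul_const _
  · refine (ae_restrict_iff' measurableSet_Ioo).2 (ae_of_all _ fun t ht => ?_)
    have h1 := min_le_one_sub_mul (z := z₀) ht
    have h2 : 0 < 1 - z₀ * t := hM0.trans_le h1
    have h3 : 0 < 1 - (z₀ + z) * t := by
      have : z * t ≤ |z| := (le_abs_self _).trans (by
        rw [abs_mul, abs_of_pos ht.1]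
        exact mul_le_of_le_one_right (abs_nonneg _) ht.2.le)
      nlinarith
    have hr : |z * t / (1 - z₀ * t)| < 1 := by
      rw [abs_div, abs_of_pos h2, div_lt_one h2, abs_mul, abs_of_pos ht.1]
      exact (mul_le_of_le_one_right (abs_nonneg _) ht.2.le).trans_lt (hz.trans_le h1)
    have hg := (hasSum_geometric_of_abs_lt_one hr).mul_left (t ^ (b - 1) / (1 - z₀ * t))
    have hval : t ^ (b - 1) / (1 - z₀ * t) * (1 - z * t / (1 - z₀ * t))⁻¹ =
        t ^ (b - 1) / (1 - (z₀ + z) * t) := by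
      rw [show 1 - z * t / (1 - z₀ * t) = (1 - (z₀ + z) * t) / (1 - z₀ * t) by
        rw [eq_div_iff h2.ne', sub_mul, div_mul_cancel₀ _ h2.ne']; ring]
      field_simp
    rw [hval] at hg
    refine hg.congr_fun fun n => ?_
    rw [div_pow, mul_pow, pow_succ]
    field_simp

lemma analyticAt_eulerIntegral {b : ℝ} (hb : 0 < b) {z₀ : ℝ} (hz₀ : z₀ < 1) :
    AnalyticAt ℝ (fun z => ∫ t in Ioo (0 : ℝ) 1, t ^ (b - 1) / (1 - z * t)) z₀ := by
  refine ⟨FormalMultilinearSeries.ofScalars ℝ fun n : ℕ =>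
    ∫ t in Ioo (0 : ℝ) 1, t ^ (b - 1) * (t ^ n / (1 - z₀ * t) ^ (n + 1)), ?_⟩
  rw [hasFPowerSeriesAt_iff]
  have hM0 : 0 < min 1 (1 - z₀) := lt_min one_pos (by linarith)
  filter_upwards [Metric.ball_mem_nhds (0 : ℝ) hM0] with z hz
  rw [Metric.mem_ball, dist_zero_right, Real.norm_eq_abs] at hz
  simpa only [FormalMultilinearSeries.coeff_ofScalars, smul_eq_mul] using
    hasSum_eulerIntegral hb hz₀ hz

lemma ascPochhammer_eval_div {b : ℝ} (hb : 0 < b) (n : ℕ) :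
    (ascPochhammer ℝ n).eval b * ((ascPochhammer ℝ n).eval (b + 1))⁻¹ = b / (b + n) := by
  induction n with
  | zero => simp [hb.ne']
  | succ n ih =>
    have h1 : (ascPochhammer ℝ n).eval (b + 1) ≠ 0 :=
      (ascPochhammer_pos n (b + 1) (by linarith)).ne'
    have h2 : b + n ≠ 0 := by positivity
    have h3 : b + 1 + n ≠ 0 := by positivity
    have h4 : b + (n + 1) ≠ 0 := by positivity
    rw [← div_eq_mul_inv, div_eq_div_iff h1 h2] at ih
    rw [ascPochhammer_succ_eval, ascPochhammer_succ_eval, ← div_eq_mul_inv, Nat.cast_succ,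
      div_eq_div_iff (mul_ne_zero h1 h3) h4]
    linear_combination (b + 1 + n) * ih

lemma eulerIntegral_eq_ordinaryHypergeometric {b : ℝ} (hb : 0 < b) {z : ℝ}
    (hz : z ∈ Ioo (-1 : ℝ) 1) :
    b * ∫ t in Ioo (0 : ℝ) 1, t ^ (b - 1) / (1 - z * t) = ₂F₁ 1 b (b + 1) z := by
  have h := (hasSum_eulerIntegral hb (z₀ := 0) (z := z) one_pos
    (by simpa [abs_lt] using hz)).mul_left b
  rw [zero_add] at h
  rw [← h.tsum_eq, ordinaryHypergeometric_eq_tsum]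
  refine tsum_congr fun n => ?_
  have hint : ∫ t in Ioo (0 : ℝ) 1, t ^ (b - 1) * (t ^ n / (1 - 0 * t) ^ (n + 1)) =
      1 / (b + n) := by
    calc _ = ∫ t in Ioo (0 : ℝ) 1, t ^ (b - 1 + n) := by
          refine setIntegral_congr_fun measurableSet_Ioo fun t ht => ?_
          simp [Real.rpow_add_natCast ht.1.ne']
      _ = ∫ t in (0 : ℝ)..1, t ^ (b - 1 + n) := by
          rw [intervalIntegral.integral_of_le zero_le_one, integral_Ioc_eq_integral_Ioo]
      _ = _ := by
          have : 0 < b + n := by positivity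
          rw [integral_rpow (Or.inl (by linarith [n.cast_nonneg (α := ℝ)])),
            show b - 1 + n + 1 = b + n by ring, Real.one_rpow, Real.zero_rpow this.ne', sub_zero]
  have hfac : (n.factorial : ℝ) ≠ 0 := by positivity
  rw [hint, smul_eq_mul, ascPochhammer_eval_one, inv_mul_cancel₀ hfac, one_mul,
    ascPochhammer_eval_div hb]
  ring

/-- The analytic continuation of `₂F₁(1, b; b + 1; ·)` to `(-∞, 1)` is Euler's integral. -/
theorem gaussHypergeometric_one_eq_integral {b : ℝ} (hb : 0 < b) {z : ℝ} (hz : z < 1) :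
    gaussHypergeometric 1 b (b + 1) z = b * ∫ t in Ioo (0 : ℝ) 1, t ^ (b - 1) / (1 - z * t) := by
  set G : ℝ → ℝ := fun z => b * ∫ t in Ioo (0 : ℝ) 1, t ^ (b - 1) / (1 - z * t) with hG
  have hGa : AnalyticOnNhd ℝ G (Iio 1) := fun w hw =>
    analyticAt_const.mul (analyticAt_eulerIntegral hb hw)
  have hGs : ∀ w ∈ Ioo (-1 : ℝ) 1, G w = ₂F₁ 1 b (b + 1) w := fun w hw =>
    eulerIntegral_eq_ordinaryHypergeometric hb hw
  obtain ⟨hFa, hFs⟩ := Classical.epsilon_spec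
    (p := fun F : ℝ → ℝ => AnalyticOnNhd ℝ F (Iio 1) ∧
      ∀ z ∈ Ioo (-1 : ℝ) 1, F z = ₂F₁ 1 b (b + 1) z)
    ⟨G, hGa, hGs⟩
  refine hFa.eqOn_of_preconnected_of_eventuallyEq hGa isPreconnected_Iio
    (z₀ := 0) (by simp) ?_ hz
  filter_upwards [Ioo_mem_nhds (show (-1 : ℝ) < 0 by norm_num) one_pos] with w hw
  rw [hFs w hw, hGs w hw]

/-- For `b = 1 / 2` Euler's integral is an inverse tangent. -/
lemma integral_inv_sqrt_div_one_add_mul {θ : ℝ} (hθ : 0 < θ) :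
    ∫ t in Ioo (0 : ℝ) 1, t ^ (1 / 2 - 1 : ℝ) / (1 - -θ * t) =
      2 * Real.arctan (Real.sqrt θ) / Real.sqrt θ := by
  have hs : 0 < Real.sqrt θ := Real.sqrt_pos.2 hθ
  rw [← integral_Ioc_eq_integral_Ioo, ← intervalIntegral.integral_of_le zero_le_one]
  have hd : ∀ t ∈ Ioo (0 : ℝ) 1, HasDerivAt
      (fun t => 2 * Real.arctan (Real.sqrt θ * Real.sqrt t) / Real.sqrt θ)
      (t ^ (1 / 2 - 1 : ℝ) / (1 - -θ * t)) t := by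
    intro t ht
    have h := ((((Real.hasDerivAt_sqrt ht.1.ne').const_mul (Real.sqrt θ)).arctan).const_mul
      2).div_const (Real.sqrt θ)
    convert! h using 1
    have ht' : 0 < Real.sqrt t := Real.sqrt_pos.2 ht.1
    have h1 : 0 < 1 + θ * t := by have := mul_pos hθ ht.1; linarith
    rw [show (1 / 2 - 1 : ℝ) = -(1 / 2) by norm_num, Real.rpow_neg ht.1.le, ← Real.sqrt_eq_rpow,
      mul_pow, Real.sq_sqrt hθ.le, Real.sq_sqrt ht.1.le, neg_mul, sub_neg_eq_add]
    field_simp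
  have hint : IntervalIntegrable (fun t : ℝ => t ^ (1 / 2 - 1 : ℝ) / (1 - -θ * t)) volume 0 1 := by
    have h := intervalIntegral.intervalIntegrable_rpow' (a := 0) (b := 1)
      (show (-1 : ℝ) < 1 / 2 - 1 by norm_num)
    refine h.mul_continuousOn (g := fun t => (1 - -θ * t)⁻¹) (ContinuousOn.inv₀ (by fun_prop) ?_)
    intro t ht
    rw [uIcc_of_le zero_le_one] at ht
    have := mul_nonneg hθ.le ht.1
    rw [neg_mul, sub_neg_eq_add]
    positivity
  rw [intervalIntegral.integral_eq_sub_of_hasDerivAt_of_le zero_le_one (by fun_prop) hd hint]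
  simp

/-! ### Spatial integration of the inter-cell interference -/

/-- The expected loss `1 - E exp (-θ R ^ η g r ^ (-η))` with a unit-mean exponential gain `g`,
caused by an interferer at distance `r` from the receiver whose own base station is at distance
`R < r`. -/
noncomputable def radialLoss (η θ R r : ℝ) : ℝ :=
  (Ioi R).indicator (fun r => 1 - 1 / (1 + θ * (R ^ η * r ^ (-η)))) r

lemma radialLoss_nonneg {η θ R r : ℝ} (hθ : 0 < θ) (hR : 0 ≤ R) : 0 ≤ radialLoss η θ R r := by
  refine indicator_nonneg (fun r hr => ?_) r
  have hr0 : 0 ≤ r := hR.trans (le_of_lt hr)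
  have : 0 ≤ θ * (R ^ η * r ^ (-η)) := by positivity
  rw [sub_nonneg]
  exact div_le_one_of_le₀ (by linarith) (by linarith)

lemma radialLoss_zero {η θ r : ℝ} (hη : 2 < η) : radialLoss η θ 0 r = 0 := by
  simp [radialLoss, Real.zero_rpow (show η ≠ 0 by linarith)]

/-- The substitution `r = R t ^ (-1 / η)` turns the radial loss into the integrand of Euler's
integral. -/
lemma radialLoss_comp_rpow {η θ R t : ℝ} (hη : 2 < η) (hθ : 0 < θ) (hR : 0 < R) (ht : 0 < t) :
    (|-1 / η| * t ^ (-1 / η - 1)) * (R * t ^ (-1 / η) * radialLoss η θ R (R * t ^ (-1 / η))) =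
      (Iio 1).indicator
        (fun t => R * (θ / η) * (t ^ ((1 - 2 / η) - 1) / (1 - -θ * t))) t := by
  have hη0 : 0 < η := by linarith
  have hp : -1 / η < 0 := div_neg_of_neg_of_pos (by norm_num) hη0
  have hmem : R * t ^ (-1 / η) ∈ Ioi R ↔ t ∈ Iio (1 : ℝ) := by
    rw [mem_Ioi, mem_Iio, lt_mul_iff_one_lt_right hR, Real.one_lt_rpow_iff_of_pos ht]
    constructor
    · rintro (⟨_, h⟩ | ⟨h, _⟩)
      · exact absurd h (not_lt.2 hp.le)
      · exact h
    · exact fun h => Or.inr ⟨h, hp⟩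
  by_cases h : t ∈ Iio (1 : ℝ)
  · rw [radialLoss, indicator_of_mem (hmem.2 h), indicator_of_mem h]
    have h1 : R ^ η * (R * t ^ (-1 / η)) ^ (-η) = t := by
      rw [Real.mul_rpow hR.le (by positivity), ← Real.rpow_mul ht.le, ← mul_assoc,
        ← Real.rpow_add hR, add_neg_cancel, Real.rpow_zero, one_mul,
        show -1 / η * -η = 1 by field_simp, Real.rpow_one]
    have h2 : t ^ ((1 - 2 / η) - 1) = t ^ (-1 / η - 1) * t ^ (-1 / η) * t := by
      rw [← Real.rpow_add ht]
      nth_rewrite 3 [← Real.rpow_one t]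
      rw [← Real.rpow_add ht]
      congr 1; ring
    have h3 : 0 < 1 + θ * t := by positivity
    rw [h1, h2, abs_of_neg hp, show 1 - -θ * t = 1 + θ * t by ring]
    field_simp
    ring
  · rw [radialLoss, indicator_of_notMem (fun h' => h (hmem.1 h')), indicator_of_notMem h]
    simp

lemma integrableOn_eulerIntegrand {b θ : ℝ} (hb : 0 < b) (hθ : 0 < θ) :
    IntegrableOn (fun t : ℝ => t ^ (b - 1) / (1 - -θ * t)) (Ioo 0 1) := by
  refine (integrableOn_rpow_sub_one hb).mono' (Measurable.aestronglyMeasurable (by fun_prop))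
    ((ae_restrict_iff' measurableSet_Ioo).2 (ae_of_all _ fun t ht => ?_))
  have h1 : 0 ≤ t ^ (b - 1) := Real.rpow_nonneg ht.1.le _
  have h2 : 1 ≤ 1 - -θ * t := by have := mul_pos hθ ht.1; linarith
  rw [Real.norm_eq_abs, abs_of_nonneg (by positivity)]
  exact div_le_self h1 h2

lemma integral_mul_radialLoss {η θ R : ℝ} (hη : 2 < η) (hθ : 0 < θ) (hR : 0 < R) :
    IntegrableOn (fun r => r * radialLoss η θ R r) (Ioi 0) ∧
    ∫ r in Ioi (0 : ℝ), r * radialLoss η θ R r =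
      R ^ 2 * (θ / η) * ∫ t in Ioo (0 : ℝ) 1, t ^ ((1 - 2 / η) - 1) / (1 - -θ * t) := by
  have hη0 : 0 < η := by linarith
  have hp : -1 / η ≠ 0 := (div_neg_of_neg_of_pos (by norm_num) hη0).ne
  have hb : 0 < 1 - 2 / η := by rw [sub_pos, div_lt_one hη0]; exact hη
  set k : ℝ → ℝ := fun r => r * radialLoss η θ R r with hk
  have hcong : EqOn (fun t => (|-1 / η| * t ^ (-1 / η - 1)) • k (R * t ^ (-1 / η)))
      ((Iio 1).indicator
        (fun t => R * (θ / η) * (t ^ ((1 - 2 / η) - 1) / (1 - -θ * t)))) (Ioi 0) := fun t ht =>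
    radialLoss_comp_rpow hη hθ hR ht
  constructor
  · have h1 : IntegrableOn ((Iio 1).indicator
        (fun t => R * (θ / η) * (t ^ ((1 - 2 / η) - 1) / (1 - -θ * t)))) (Ioi (0 : ℝ)) := by
      rw [IntegrableOn, integrable_indicator_iff measurableSet_Iio, IntegrableOn,
        Measure.restrict_restrict measurableSet_Iio, Iio_inter_Ioi]
      exact (integrableOn_eulerIntegrand hb hθ).const_mul _
    have h2 := h1.congr_fun hcong.symm measurableSet_Ioi
    rw [integrableOn_Ioi_comp_rpow_iff (fun u => k (R * u)) hp,
      integrableOn_Ioi_comp_mul_left_iff k 0 hR, mul_zero] at h2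
    exact h2
  · have h1 := integral_comp_rpow_Ioi (fun u => k (R * u)) hp
    rw [integral_comp_mul_left_Ioi k 0 hR, mul_zero, setIntegral_congr_fun measurableSet_Ioi hcong,
      setIntegral_indicator measurableSet_Iio, Ioi_inter_Iio, integral_const_mul, smul_eq_mul,
      eq_inv_mul_iff_mul_eq₀ hR.ne'] at h1
    rw [← h1]
    ring

lemma lintegral_radialLoss {η θ R : ℝ} (hη : 2 < η) (hθ : 0 < θ) (hR : 0 ≤ R) (z : Plane) :
    ∫⁻ y : Plane, ENNReal.ofReal (radialLoss η θ R ‖y - z‖) =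
      ENNReal.ofReal (R ^ 2) * ENNReal.ofReal (2 * Real.pi * (θ / η) *
        ∫ t in Ioo (0 : ℝ) 1, t ^ ((1 - 2 / η) - 1) / (1 - -θ * t)) := by
  rw [lintegral_sub_right_eq_self (fun y : Plane => ENNReal.ofReal (radialLoss η θ R ‖y‖)) z]
  rcases hR.eq_or_lt with rfl | hR'
  · simp [radialLoss_zero hη]
  obtain ⟨hint, hval⟩ := integral_mul_radialLoss hη hθ hR'
  have hint' : Integrable (fun y : Plane => radialLoss η θ R ‖y‖) := by
    rw [integrable_fun_norm_addHaar (volume : Measure Plane)]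
    simpa using hint
  rw [← ofReal_integral_eq_lintegral_ofReal hint'
    (ae_of_all _ fun y => radialLoss_nonneg hθ hR),
    integral_fun_norm_addHaar (volume : Measure Plane) (radialLoss η θ R),
    ← ENNReal.ofReal_mul (by positivity)]
  congr 1
  simp only [finrank_euclideanSpace, Fintype.card_fin, Nat.add_one_sub_one, pow_one, smul_eq_mul,
    nsmul_eq_mul, Measure.real, EuclideanSpace.volume_ball_fin_two, hval]
  simp [Real.pi_nonneg]
  ring

section Marks

/-! ### Marks of the devices -/

lemma isProbabilityMeasure_channelLaw {c : ℝ} (hc : 0 < c) :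
    IsProbabilityMeasure (channelLaw c) := by
  constructor
  have hf : (⌊c⌋₊ : ℝ) ≤ c := Nat.floor_le hc.le
  simp only [channelLaw, Measure.add_apply, Measure.finsetSum_apply, Measure.smul_apply,
    measure_univ, smul_eq_mul, mul_one, Finset.sum_const, Finset.card_range, nsmul_eq_mul]
  rw [← ENNReal.ofReal_natCast, ← ENNReal.ofReal_mul (Nat.cast_nonneg _),
    ← ENNReal.ofReal_add (by positivity) (div_nonneg (sub_nonneg.2 hf) hc.le),
    ← ENNReal.ofReal_one]
  congr 1
  field_simp
  ring

lemma channelLaw_singleton {c : ℝ} {o : ℕ} (ho : o < ⌊c⌋₊) :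
    channelLaw c {o} = ENNReal.ofReal (1 / c) := by
  simp only [channelLaw, Measure.add_apply, Measure.finsetSum_apply, Measure.smul_apply,
    Measure.dirac_apply, smul_eq_mul]
  rw [Finset.sum_eq_single o]
  · simp [indicator, ho.ne']
  · intro b _ hb
    simp [indicator, hb]
  · intro h
    exact absurd (Finset.mem_range.2 ho) h

variable {N : ℕ} {S : Params N}

lemma channels_pos {m : Allocation} {i : Fin N} {o : ℕ} (ho : o < ⌊S.channels m i⌋₊) :
    0 < S.channels m i :=
  zero_lt_one.trans_le (Nat.floor_pos.1 (o.zero_le.trans_lt ho))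

lemma ζ_nonneg (π : Measure S.QueueState) (i : Fin N) : 0 ≤ S.ζ π i :=
  Finset.sum_nonneg fun _ _ => measureReal_nonneg

/-- `ζ i` is the probability that class `i` is the class a device transmits. -/
lemma measure_active (π : Measure S.QueueState) [IsProbabilityMeasure π] (i : Fin N) :
    π {q | (∀ j, j < i → (q j : ℕ) = 0) ∧ (q i : ℕ) ≠ 0} = ENNReal.ofReal (S.ζ π i) := by
  have hset : {q : S.QueueState | (∀ j, j < i → (q j : ℕ) = 0) ∧ (q i : ℕ) ≠ 0} =
      ⋃ z ∈ Finset.Icc 1 (S.k i),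
        {q : S.QueueState | (∀ j, j < i → (q j : ℕ) = 0) ∧ (q i : ℕ) = z} := by
    ext q
    simp only [mem_ofPred_eq, mem_iUnion, Finset.mem_Icc, exists_prop]
    constructor
    · rintro ⟨h1, h2⟩
      exact ⟨q i, ⟨Nat.one_le_iff_ne_zero.2 h2, Nat.lt_succ_iff.1 (q i).2⟩, h1, rfl⟩
    · rintro ⟨z, ⟨hz, _⟩, h1, h2⟩
      exact ⟨h1, by omega⟩
  rw [hset, ← ofReal_measureReal (h := measure_ne_top _ _), measureReal_biUnion_finset]
  · rfl
  · intro x _ y _ hxy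
    refine Set.disjoint_left.2 fun q hq hq' => hxy ?_
    exact hq.2.symm.trans hq'.2
  · exact fun z _ => (toFinite _).measurableSet

lemma measurableSet_interferes (i : Fin N) (o : ℕ) : MeasurableSet (S.interferes i o) := by
  have h : S.interferes i o = univ ×ˢ
      ({q : S.QueueState | (∀ j, j < i → (q j : ℕ) = 0) ∧ (q i : ℕ) ≠ 0} ×ˢ {o}) := by
    ext x
    simp [Params.interferes, and_assoc]
  rw [h]
  exact MeasurableSet.univ.prod (((toFinite _).measurableSet).prod (measurableSet_singleton o))

variable {π : Measure S.QueueState} [IsProbabilityMeasure π] {m : Allocation} {i : Fin N} {o : ℕ}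

lemma isProbabilityMeasure_markLaw (ho : o < ⌊S.channels m i⌋₊) :
    IsProbabilityMeasure (S.markLaw π m i) := by
  have := isProbabilityMeasure_channelLaw (channels_pos ho)
  have := isProbabilityMeasure_expMeasure_one
  unfold Params.markLaw
  infer_instance

lemma lintegral_indicator_interferes (ho : o < ⌊S.channels m i⌋₊) {φ : ℝ → ℝ≥0∞}
    (hφ : Measurable φ) :
    ∫⁻ x, (S.interferes i o).indicator (fun x => φ x.1) x ∂(S.markLaw π m i) =
      (∫⁻ h, φ h ∂expMeasure 1) * ENNReal.ofReal (S.ζ π i / S.channels m i) := by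
  have := isProbabilityMeasure_channelLaw (channels_pos ho)
  have := isProbabilityMeasure_expMeasure_one
  set B : Set (S.QueueState × ℕ) :=
    {q : S.QueueState | (∀ j, j < i → (q j : ℕ) = 0) ∧ (q i : ℕ) ≠ 0} ×ˢ {o} with hB
  have hBm : MeasurableSet B := ((toFinite _).measurableSet).prod (measurableSet_singleton o)
  have h : ∀ x : S.Mark, (S.interferes i o).indicator (fun x => φ x.1) x =
      φ x.1 * B.indicator 1 x.2 := by
    intro x
    have hx : x ∈ S.interferes i o ↔ x.2 ∈ B := by
      simp [Params.interferes, hB, and_assoc]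
    by_cases h : x.2 ∈ B
    · rw [indicator_of_mem (hx.2 h), indicator_of_mem h, Pi.one_apply, mul_one]
    · rw [indicator_of_notMem (fun h' => h (hx.1 h')), indicator_of_notMem h, mul_zero]
  simp_rw [h]
  rw [Params.markLaw, lintegral_prod_mul hφ.aemeasurable
    (measurable_one.indicator hBm).aemeasurable, lintegral_indicator_one hBm, hB,
    Measure.prod_prod, measure_active, channelLaw_singleton ho,
    ← ENNReal.ofReal_mul (ζ_nonneg π i), mul_one_div]

/-- The expected loss of the Laplace transform caused by one device which is received with average
power `a`. -/
lemma lintegral_one_sub_expNeg_mark (ho : o < ⌊S.channels m i⌋₊) {a : ℝ} (ha : 0 ≤ a) :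
    ∫⁻ x, (1 - expNeg ((S.interferes i o).indicator (fun x => ENNReal.ofReal (a * x.1)) x))
        ∂(S.markLaw π m i) =
      ENNReal.ofReal ((1 - 1 / (1 + a)) * (S.ζ π i / S.channels m i)) := by
  have := isProbabilityMeasure_expMeasure_one
  have h : ∀ x : S.Mark,
      1 - expNeg ((S.interferes i o).indicator (fun x => ENNReal.ofReal (a * x.1)) x) =
      (S.interferes i o).indicator (fun x => 1 - expNeg (ENNReal.ofReal (a * x.1))) x := by
    intro x
    by_cases hx : x ∈ S.interferes i o <;> simp [hx]
  have hle : (1 : ℝ) / (1 + a) ≤ 1 := div_le_one_of_le₀ (by linarith) (by linarith)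
  simp_rw [h]
  rw [lintegral_indicator_interferes (φ := fun g => 1 - expNeg (ENNReal.ofReal (a * g))) ho
      (by fun_prop),
    lintegral_sub (by fun_prop) (by
      rw [lintegral_expNeg_expMeasure ha]; exact ENNReal.ofReal_ne_top)
      (ae_of_all _ fun _ => expNeg_le_one _),
    lintegral_expNeg_expMeasure ha, lintegral_one, measure_univ, ← ENNReal.ofReal_one,
    ← ENNReal.ofReal_sub _ (by positivity), ← ENNReal.ofReal_mul (sub_nonneg.2 hle)]

/-! ### Intra-cell interference -/

lemma lintegral_prod_eq_prod_lintegral_of_aemeasurable {Ω ι : Type*} [MeasurableSpace Ω]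
    {P : Measure Ω} (s : Finset ι) (Y : ι → Ω → ℝ≥0∞) (hY : iIndepFun Y P)
    (hm : ∀ j, AEMeasurable (Y j) P) :
    ∫⁻ ω, ∏ j ∈ s, Y j ω ∂P = ∏ j ∈ s, ∫⁻ ω, Y j ω ∂P := by
  have h := lintegral_prod_eq_prod_lintegral_of_indepFun s (fun j => (hm j).mk)
    (hY.congr fun j => (hm j).ae_eq_mk) fun j => (hm j).measurable_mk
  have hae : ∀ᵐ ω ∂P, ∀ j ∈ s, Y j ω = (hm j).mk (Y j) ω :=
    (ae_ball_iff s.countable_toSet).2 fun j _ => (hm j).ae_eq_mk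
  rw [lintegral_congr_ae (g := fun ω => ∏ j ∈ s, (hm j).mk (Y j) ω), h]
  · exact Finset.prod_congr rfl fun j _ => (lintegral_congr_ae (hm j).ae_eq_mk).symm
  · filter_upwards [hae] with ω hω
    exact Finset.prod_congr rfl hω

variable {Ω : Type*} [MeasurableSpace Ω] {P : Measure Ω}
  {X : Snapshot S Ω} {distLaw : Measure ℝ}

/-- The contribution of the intra-cell interference to the coverage probability, in the presence of
a factor `G` that depends on the device process only. Given the number
of devices in the cell, it is a power of the Laplace transform of a single contribution; averaging
over the Poisson number of devices and the gamma distributed area gives the stated value. -/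
lemma lintegral_expNeg_intraCell_mul (hS : S.Valid) (hX : X.IsNetwork P distLaw π m i)
    (ho : o < ⌊S.channels m i⌋₊) {G : Measure (Plane × ℝ × S.Mark) → ℝ≥0∞} (hG : Measurable G) :
    ∫⁻ ω, expNeg (ENNReal.ofReal (S.θ / S.ρ) * X.intraCell i o ω) * G (X.devices ω) ∂P =
      ENNReal.ofReal ((cellConst * S.bsDensity / (cellConst * S.bsDensity +
        S.devDensity * ((1 - 1 / (1 + S.θ)) * (S.ζ π i / S.channels m i)))) ^ cellConst) *
      ∫⁻ ω, G (X.devices ω) ∂P := by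
  have hθ := hS.θ_pos
  have hρ := hS.ρ_pos
  have hc := channels_pos ho
  have hcc : (0 : ℝ) < cellConst := by norm_num [cellConst]
  have := isProbabilityMeasure_markLaw (π := π) ho
  set L : ℝ := (1 - 1 / (1 + S.θ)) * (S.ζ π i / S.channels m i) with hL
  have hL0 : 0 ≤ L := by
    have h1 : (1 : ℝ) / (1 + S.θ) ≤ 1 := div_le_one_of_le₀ (by linarith) (by linarith)
    exact mul_nonneg (sub_nonneg.2 h1) (div_nonneg (ζ_nonneg π i) hc.le)
  set e : S.Mark → ℝ≥0∞ := fun x =>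
    expNeg ((S.interferes i o).indicator (fun x => ENNReal.ofReal (S.θ * x.1)) x) with he
  have hem : Measurable e :=
    measurable_expNeg.comp ((by fun_prop : Measurable fun x : S.Mark =>
      ENNReal.ofReal (S.θ * x.1)).indicator (measurableSet_interferes i o))
  set q : ℝ≥0∞ := ∫⁻ x, e x ∂(S.markLaw π m i) with hq
  have hqL : q + ENNReal.ofReal L = 1 := by
    rw [hq, hL, ← lintegral_one_sub_expNeg_mark ho hθ.le, ← lintegral_add_left hem]
    simp [he, add_tsub_cancel_of_le (expNeg_le_one _)]
  have hq1 : q ≤ 1 := hqL ▸ le_self_add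
  have h1q : 1 - q = ENNReal.ofReal L := by
    rw [← hqL]
    exact ENNReal.add_sub_cancel_left (ne_top_of_le_ne_top ENNReal.one_ne_top hq1)
  have hmark : ∀ n, AEMeasurable (X.cellMark n) P := fun n => (hX.cellMark_law n).aemeasurable
  have hmarks : AEMeasurable (fun ω n => X.cellMark n ω) P := aemeasurable_pi_iff.2 hmark
  have hprod : ∀ n, ∫⁻ ω, ∏ j ∈ Finset.range n, e (X.cellMark j ω) ∂P = q ^ n := by
    intro n
    rw [lintegral_prod_eq_prod_lintegral_of_aemeasurable (Finset.range n)
      (fun j ω => e (X.cellMark j ω)) (hX.cellMark_indep.comp (fun _ => e) fun _ => hem)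
      fun j => hem.comp_aemeasurable (hmark j)]
    simp_rw [(hX.cellMark_law _).lintegral_comp hem.aemeasurable]
    simp [hq]
  have hEm : ∀ n, Measurable fun x : ℕ → S.Mark => ∏ j ∈ Finset.range n, e (x j) := fun n =>
    Finset.measurable_prod _ fun j _ => hem.comp (measurable_pi_apply j)
  have hexp : ∀ ω, expNeg (ENNReal.ofReal (S.θ / S.ρ) * X.intraCell i o ω) =
      ∏ j ∈ Finset.range (X.cellCount ω), e (X.cellMark j ω) := by
    intro ω
    rw [Snapshot.intraCell, Finset.mul_sum, expNeg_sum]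
    refine Finset.prod_congr rfl fun j _ => ?_
    simp only [he]
    congr 1
    by_cases hx : X.cellMark j ω ∈ S.interferes i o
    · rw [indicator_of_mem hx, indicator_of_mem hx, ← ENNReal.ofReal_mul (by positivity)]
      congr 1
      field_simp
    · rw [indicator_of_notMem hx, indicator_of_notMem hx, mul_zero]
  -- Splitting by the number of devices makes the product of a random number of factors accessible
  -- to independence.
  have hdec : ∀ ω, expNeg (ENNReal.ofReal (S.θ / S.ρ) * X.intraCell i o ω) * G (X.devices ω) =
      ∑' n : ℕ, ({n} : Set ℕ).indicator 1 (X.cellCount ω) *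
        ((∏ j ∈ Finset.range n, e (X.cellMark j ω)) * G (X.devices ω)) := by
    intro ω
    rw [hexp, tsum_eq_single (X.cellCount ω)]
    · simp
    · intro n hn
      rw [indicator_of_notMem (by simpa using hn.symm), zero_mul]
  have hdev : Measurable X.devices := hX.devices_poisson.measurable
  have hterm : ∀ n : ℕ, ∫⁻ ω, ({n} : Set ℕ).indicator 1 (X.cellCount ω) *
        ((∏ j ∈ Finset.range n, e (X.cellMark j ω)) * G (X.devices ω)) ∂P =
      P (X.cellCount ⁻¹' {n}) * q ^ n * ∫⁻ ω, G (X.devices ω) ∂P := by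
    intro n
    have hf1 : Measurable fun v : ℝ × ℕ => ({n} : Set ℕ).indicator (1 : ℕ → ℝ≥0∞) v.2 :=
      (measurable_one.indicator (measurableSet_singleton n)).comp measurable_snd
    have hf2 : Measurable fun v : (ℕ → S.Mark) × Measure (Plane × ℝ × S.Mark) =>
        (∏ j ∈ Finset.range n, e (v.1 j)) * G v.2 :=
      ((hEm n).comp measurable_fst).mul (hG.comp measurable_snd)
    have hi1 := hX.indep_cell.comp hf1 hf2
    have hi2 := hX.indep_mark.comp (hEm n) hG
    have hK : Measurable fun ω => ({n} : Set ℕ).indicator (1 : ℕ → ℝ≥0∞) (X.cellCount ω) :=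
      (measurable_one.indicator (measurableSet_singleton n)).comp hX.cellCount_measurable
    have hE : AEMeasurable (fun ω => ∏ j ∈ Finset.range n, e (X.cellMark j ω)) P :=
      (hEm n).comp_aemeasurable hmarks
    have hGd : AEMeasurable (fun ω => G (X.devices ω)) P := (hG.comp hdev).aemeasurable
    have hEG : AEMeasurable
        (fun ω => (∏ j ∈ Finset.range n, e (X.cellMark j ω)) * G (X.devices ω)) P := hE.mul hGd
    rw [lintegral_mul_eq_lintegral_mul_lintegral_of_indepFun'' hK.aemeasurable hEG hi1,
      lintegral_mul_eq_lintegral_mul_lintegral_of_indepFun'' hE hGd hi2, hprod, mul_assoc]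
    congr 1
    rw [← lintegral_indicator_one (hX.cellCount_measurable (measurableSet_singleton n))]
    rfl
  have hpm : ∀ n : ℕ, Measurable fun a : ℝ => poissonMeasure (S.devDensity * a).toNNReal {n} := by
    intro n
    simp_rw [poissonMeasure_singleton]
    fun_prop
  simp_rw [hdec]
  rw [lintegral_tsum]
  · simp_rw [hterm]
    rw [ENNReal.tsum_mul_right]
    congr 1
    have hcount : ∀ n : ℕ, P (X.cellCount ⁻¹' {n}) =
        ∫⁻ a, poissonMeasure (S.devDensity * a).toNNReal {n}
          ∂(gammaMeasure cellConst (cellConst * S.bsDensity)) := fun n => by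
      simpa using hX.cellCount_law n univ MeasurableSet.univ
    simp_rw [hcount]
    calc ∑' n : ℕ, (∫⁻ a, poissonMeasure (S.devDensity * a).toNNReal {n}
            ∂(gammaMeasure cellConst (cellConst * S.bsDensity))) * q ^ n
        = ∫⁻ a, ∑' n : ℕ, poissonMeasure (S.devDensity * a).toNNReal {n} * q ^ n
            ∂(gammaMeasure cellConst (cellConst * S.bsDensity)) := by
          rw [lintegral_tsum fun n => ((hpm n).mul_const _).aemeasurable]
          exact tsum_congr fun n => (lintegral_mul_const _ (hpm n)).symm
      _ = ∫⁻ a, expNeg (ENNReal.ofReal (S.devDensity * L * a))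
            ∂(gammaMeasure cellConst (cellConst * S.bsDensity)) := by
          refine lintegral_congr fun a => ?_
          rw [tsum_poissonMeasure_mul_pow _ hq1, h1q]
          change expNeg (ENNReal.ofReal (S.devDensity * a) * ENNReal.ofReal L) = _
          rw [← ENNReal.ofReal_mul' hL0]
          congr 2; ring
      _ = _ := lintegral_expNeg_gammaMeasure hcc (mul_pos hcc hS.bsDensity_pos)
          (mul_nonneg hS.devDensity_pos.le hL0)
  · intro n
    exact (((measurable_one.indicator (measurableSet_singleton n)).comp
      hX.cellCount_measurable).aemeasurable).mul
      (((hEm n).comp_aemeasurable hmarks).mul (hG.comp hdev).aemeasurable)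

end Marks

section Coverage

/-! ### Inter-cell interference -/

variable {N : ℕ} {S : Params N} {π : Measure S.QueueState}
  {m : Allocation} {i : Fin N} {o : ℕ}

lemma measurable_outContribution (S : Params N) (z : Plane) (i : Fin N) (o : ℕ) :
    Measurable (S.outContribution z i o) := by
  refine Measurable.indicator ?_ ?_
  · unfold Params.txPower
    fun_prop
  · have h1 : Measurable fun v : Plane × ℝ × S.Mark => v.2.1 := by fun_prop
    have h2 : Measurable fun v : Plane × ℝ × S.Mark => ‖v.1 - z‖ := by fun_prop
    have h3 : Measurable fun v : Plane × ℝ × S.Mark => v.2.2 := by fun_prop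
    exact (measurableSet_lt h1 h2).inter (h3 (measurableSet_interferes i o))

/-- The expected loss of the Laplace transform caused by a device at `y` whose own base station is
at distance `R`. -/
lemma lintegral_one_sub_expNeg_outContribution [IsProbabilityMeasure π] (hS : S.Valid)
    (ho : o < ⌊S.channels m i⌋₊)
    (z y : Plane) {R : ℝ} (hR : 0 ≤ R) :
    ∫⁻ x, (1 - expNeg (ENNReal.ofReal (S.θ / S.ρ) * S.outContribution z i o (y, R, x)))
        ∂(S.markLaw π m i) =
      ENNReal.ofReal (radialLoss S.η S.θ R ‖y - z‖) *
        ENNReal.ofReal (S.ζ π i / S.channels m i) := by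
  have hθ := hS.θ_pos
  have hρ := hS.ρ_pos
  by_cases h : R < ‖y - z‖
  · have ha : 0 ≤ S.θ * (R ^ S.η * ‖y - z‖ ^ (-S.η)) := by positivity
    rw [radialLoss, indicator_of_mem (show ‖y - z‖ ∈ Ioi R from h),
      ← ENNReal.ofReal_mul' (div_nonneg (ζ_nonneg π i) (channels_pos ho).le),
      ← lintegral_one_sub_expNeg_mark ho ha]
    refine lintegral_congr fun x => ?_
    congr 2
    by_cases hx : x ∈ S.interferes i o
    · rw [Params.outContribution, indicator_of_mem hx, indicator_of_mem (by exact ⟨h, hx⟩),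
        ← ENNReal.ofReal_mul (by positivity), Params.txPower]
      congr 1
      field_simp
    · rw [Params.outContribution, indicator_of_notMem hx,
        indicator_of_notMem (fun hcon => hx hcon.2), mul_zero]
  · have h0 : ∀ x, S.outContribution z i o (y, R, x) = 0 := fun x =>
      indicator_of_notMem (fun hcon => h hcon.1) _
    simp [h0, radialLoss, indicator_of_notMem (show ‖y - z‖ ∉ Ioi R from h)]

/-- The Laplace transform of the inter-cell interference at `θ / ρ`. The law of the distance to the
serving base station enters through its second moment only. -/
lemma lintegral_expNeg_interCell [IsProbabilityMeasure π] {Ω : Type*} [MeasurableSpace Ω]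
    {P : Measure Ω} [IsProbabilityMeasure P] {X : Snapshot S Ω} {distLaw : Measure ℝ}
    [IsProbabilityMeasure distLaw] (hnn : ∀ᵐ R ∂distLaw, 0 ≤ R)
    (hS : S.Valid) (hX : X.IsNetwork P distLaw π m i) (ho : o < ⌊S.channels m i⌋₊) (z : Plane) :
    ∫⁻ ω, expNeg (ENNReal.ofReal (S.θ / S.ρ) * X.interCell z i o ω) ∂P =
      expNeg (ENNReal.ofReal S.devDensity * ((∫⁻ R, ENNReal.ofReal (R ^ 2) ∂distLaw) *
        ENNReal.ofReal (2 * Real.pi * (S.θ / S.η) *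
          ∫ t in Ioo (0 : ℝ) 1, t ^ ((1 - 2 / S.η) - 1) / (1 - -S.θ * t)) *
        ENNReal.ofReal (S.ζ π i / S.channels m i))) := by
  have := isProbabilityMeasure_markLaw (π := π) ho
  have : SigmaFinite (ENNReal.ofReal S.devDensity • (volume : Measure Plane)) :=
    inferInstanceAs (SigmaFinite (S.devDensity.toNNReal • (volume : Measure Plane)))
  have hm := measurable_outContribution S z i o
  have hm1 : Measurable fun v => ENNReal.ofReal (S.θ / S.ρ) * S.outContribution z i o v :=
    hm.const_mul _
  have hm2 : Measurable fun v =>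
      1 - expNeg (ENNReal.ofReal (S.θ / S.ρ) * S.outContribution z i o v) :=
    measurable_const.sub (measurable_expNeg.comp hm1)
  have hrl : Measurable fun v : Plane × ℝ =>
      ENNReal.ofReal (radialLoss S.η S.θ v.2 ‖v.1 - z‖) := by
    have h : (fun v : Plane × ℝ => radialLoss S.η S.θ v.2 ‖v.1 - z‖) =
        {v : Plane × ℝ | v.2 < ‖v.1 - z‖}.indicator
          fun v => 1 - 1 / (1 + S.θ * (v.2 ^ S.η * ‖v.1 - z‖ ^ (-S.η))) := by
      ext v
      by_cases hv : v.2 < ‖v.1 - z‖ <;> simp [radialLoss, hv]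
    refine ENNReal.measurable_ofReal.comp ?_
    rw [h]
    exact Measurable.indicator (by fun_prop) (measurableSet_lt (by fun_prop) (by fun_prop))
  have h1 : ∀ ω, ENNReal.ofReal (S.θ / S.ρ) * X.interCell z i o ω =
      ∫⁻ v, ENNReal.ofReal (S.θ / S.ρ) * S.outContribution z i o v ∂(X.devices ω) := fun ω =>
    (lintegral_const_mul _ hm).symm
  simp_rw [h1]
  rw [hX.devices_poisson.lintegral_expNeg hm1]
  congr 1
  rw [lintegral_prod _ hm2.aemeasurable, lintegral_smul_measure, smul_eq_mul]
  congr 1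
  calc ∫⁻ y : Plane, ∫⁻ w, (1 - expNeg (ENNReal.ofReal (S.θ / S.ρ) *
          S.outContribution z i o (y, w))) ∂(distLaw.prod (S.markLaw π m i))
      = ∫⁻ y : Plane, ∫⁻ R, ENNReal.ofReal (radialLoss S.η S.θ R ‖y - z‖) *
          ENNReal.ofReal (S.ζ π i / S.channels m i) ∂distLaw := by
        refine lintegral_congr fun y => ?_
        have hy : Measurable fun w : ℝ × S.Mark =>
            1 - expNeg (ENNReal.ofReal (S.θ / S.ρ) * S.outContribution z i o (y, w)) :=
          hm2.comp measurable_prodMk_left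
        rw [lintegral_prod _ hy.aemeasurable]
        refine lintegral_congr_ae ?_
        filter_upwards [hnn] with R hR
        exact lintegral_one_sub_expNeg_outContribution hS ho z y hR
    _ = ∫⁻ R, (∫⁻ y : Plane, ENNReal.ofReal (radialLoss S.η S.θ R ‖y - z‖)) *
          ENNReal.ofReal (S.ζ π i / S.channels m i) ∂distLaw := by
        rw [lintegral_lintegral_swap (hrl.mul_const _).aemeasurable]
        exact lintegral_congr fun R => lintegral_mul_const _ (hrl.comp measurable_prodMk_right)
    _ = ∫⁻ R, ENNReal.ofReal (R ^ 2) * ENNReal.ofReal (2 * Real.pi * (S.θ / S.η) *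
          ∫ t in Ioo (0 : ℝ) 1, t ^ ((1 - 2 / S.η) - 1) / (1 - -S.θ * t)) *
          ENNReal.ofReal (S.ζ π i / S.channels m i) ∂distLaw := by
        refine lintegral_congr_ae ?_
        filter_upwards [hnn] with R hR
        rw [lintegral_radialLoss hS.two_lt_η hS.θ_pos hR]
    _ = _ := by
        rw [lintegral_mul_const _ (by fun_prop), lintegral_mul_const _ (by fun_prop)]

/-! ### The coverage probability -/

/-- With Rayleigh fading the coverage probability is the Laplace transform of the total of
interference and noise at `θ / ρ`. -/
lemma measure_sinr_eq_lintegral {Ω : Type*} [MeasurableSpace Ω] {P : Measure Ω}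
    [IsProbabilityMeasure P] {X : Snapshot S Ω} {distLaw : Measure ℝ}
    (hS : S.Valid) (hX : X.IsNetwork P distLaw π m i) (z : Plane) (o : ℕ) :
    P {ω | ENNReal.ofReal S.θ < X.sinr z i o ω} =
      ∫⁻ ω, expNeg (ENNReal.ofReal (S.θ / S.ρ) *
        (X.intraCell i o ω + X.interCell z i o ω + ENNReal.ofReal (S.σ ^ 2))) ∂P := by
  have := isProbabilityMeasure_expMeasure_one
  set W : Ω → (ℝ × ℕ) × (ℕ → S.Mark) × Measure (Plane × ℝ × S.Mark) := fun ω =>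
    ((X.cellArea ω, X.cellCount ω), (fun n => X.cellMark n ω), X.devices ω) with hW
  have hmarks : AEMeasurable (fun ω n => X.cellMark n ω) P :=
    aemeasurable_pi_iff.2 fun n => (hX.cellMark_law n).aemeasurable
  have hWm : AEMeasurable W P :=
    (hX.cellArea_law.aemeasurable.prodMk hX.cellCount_measurable.aemeasurable).prodMk
      (hmarks.prodMk hX.devices_poisson.measurable.aemeasurable)
  have hgm := hX.gain_law.aemeasurable
  set D : (ℝ × ℕ) × (ℕ → S.Mark) × Measure (Plane × ℝ × S.Mark) → ℝ≥0∞ := fun w =>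
    ∑ n ∈ Finset.range w.1.2,
      (S.interferes i o).indicator (fun x => ENNReal.ofReal (S.ρ * x.1)) (w.2.1 n) +
    ∫⁻ v, S.outContribution z i o v ∂w.2.2 + ENNReal.ofReal (S.σ ^ 2) with hD
  have hDm : Measurable D := by
    refine (Measurable.add ?_ ?_).add_const _
    · have hi : Measurable ((S.interferes i o).indicator
          fun x : S.Mark => ENNReal.ofReal (S.ρ * x.1)) :=
        Measurable.indicator (by fun_prop) (measurableSet_interferes i o)
      have h : Measurable fun v : ℕ × (ℕ → S.Mark) => ∑ n ∈ Finset.range v.1,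
          (S.interferes i o).indicator (fun x => ENNReal.ofReal (S.ρ * x.1)) (v.2 n) :=
        measurable_from_prod_countable_right fun k => by
          change Measurable fun x : ℕ → S.Mark => ∑ n ∈ Finset.range k,
            (S.interferes i o).indicator (fun x => ENNReal.ofReal (S.ρ * x.1)) (x n)
          exact Finset.measurable_sum _ fun n _ => hi.comp (measurable_pi_apply n)
      exact h.comp (by fun_prop : Measurable
        fun w : (ℝ × ℕ) × (ℕ → S.Mark) × Measure (Plane × ℝ × S.Mark) => (w.1.2, w.2.1))
    · exact (Measure.measurable_lintegral (measurable_outContribution S z i o)).comp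
        (measurable_snd.comp measurable_snd)
  set T : Set (ℝ × ((ℝ × ℕ) × (ℕ → S.Mark) × Measure (Plane × ℝ × S.Mark))) :=
    {v | ENNReal.ofReal S.θ < ENNReal.ofReal (S.ρ * v.1) / D v.2} with hT
  have hTm : MeasurableSet T := measurableSet_lt measurable_const
    (Measurable.div (by fun_prop) (hDm.comp measurable_snd))
  have hmap := (indepFun_iff_map_prod_eq_prod_map_map hgm hWm).1 hX.indep_gain
  have : IsProbabilityMeasure (P.map W) := Measure.isProbabilityMeasure_map hWm
  calc P {ω | ENNReal.ofReal S.θ < X.sinr z i o ω}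
      = P ((fun ω => (X.gain ω, W ω)) ⁻¹' T) := rfl
    _ = ((expMeasure 1).prod (P.map W)) T := by
        rw [← Measure.map_apply_of_aemeasurable (hgm.prodMk hWm) hTm, hmap, hX.gain_law.map_eq]
    _ = ∫⁻ w, expMeasure 1 {h | ENNReal.ofReal S.θ < ENNReal.ofReal (S.ρ * h) / D w}
          ∂(P.map W) := Measure.prod_apply_symm hTm
    _ = ∫⁻ w, expNeg (ENNReal.ofReal (S.θ / S.ρ) * D w) ∂(P.map W) :=
        lintegral_congr fun w => expMeasure_one_threshold hS.θ_pos hS.ρ_pos _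
    _ = ∫⁻ ω, expNeg (ENNReal.ofReal (S.θ / S.ρ) * D (W ω)) ∂P :=
        lintegral_map' (measurable_expNeg.comp (hDm.const_mul _)).aemeasurable hWm

lemma eulerIntegral_nonneg {b θ : ℝ} (hθ : 0 < θ) :
    0 ≤ ∫ t in Ioo (0 : ℝ) 1, t ^ (b - 1) / (1 - -θ * t) := by
  refine setIntegral_nonneg measurableSet_Ioo fun t ht => ?_
  have := mul_pos hθ ht.1
  exact div_nonneg (Real.rpow_nonneg ht.1.le _) (by linarith)

/-- The coverage probability in terms of Euler's integral. -/
lemma coverage_eq [IsProbabilityMeasure π] {Ω₀ : Type*} [MeasurableSpace Ω₀]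
    {P₀ : Measure Ω₀} [IsProbabilityMeasure P₀] {Ψ : Ω₀ → Measure Plane} (hS : S.Valid)
    (hΨ : IsPoissonProcess P₀ Ψ (ENNReal.ofReal S.bsDensity • (volume : Measure Plane)))
    {Ω : Type*} [MeasurableSpace Ω] {P : Measure Ω} [IsProbabilityMeasure P] {X : Snapshot S Ω}
    (hX : X.IsNetwork P (P₀.map (fun ω => nearestDist (Ψ ω))) π m i)
    (z : Plane) (ho : o < ⌊S.channels m i⌋₊) :
    X.coverage P z i o =
      Real.exp (-(S.σ ^ 2 * S.θ / S.ρ) - 2 * S.θ * S.ζ π i * S.κ m i / S.η *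
          ∫ t in Ioo (0 : ℝ) 1, t ^ ((1 - 2 / S.η) - 1) / (1 - -S.θ * t))
        / (1 + S.θ * S.ζ π i * S.κ m i / ((1 + S.θ) * cellConst)) ^ cellConst := by
  have hθ := hS.θ_pos
  have hρ := hS.ρ_pos
  have hlam := hS.bsDensity_pos
  have hmu := hS.devDensity_pos
  have hη : 0 < S.η := two_pos.trans hS.two_lt_η
  have hc := channels_pos ho
  have hζ := ζ_nonneg π i
  have hcc : (0 : ℝ) < cellConst := by norm_num [cellConst]
  have hπ := Real.pi_pos
  have hnd : Measurable fun ω => nearestDist (Ψ ω) := measurable_nearestDist.comp hΨ.measurable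
  have : IsProbabilityMeasure (P₀.map fun ω => nearestDist (Ψ ω)) :=
    Measure.isProbabilityMeasure_map hnd.aemeasurable
  have hnn : ∀ᵐ R ∂(P₀.map fun ω => nearestDist (Ψ ω)), 0 ≤ R :=
    (ae_map_iff hnd.aemeasurable measurableSet_Ici).2 (ae_of_all _ fun ω => nearestDist_nonneg _)
  set J := ∫ t in Ioo (0 : ℝ) 1, t ^ ((1 - 2 / S.η) - 1) / (1 - -S.θ * t) with hJ
  have hJ0 : 0 ≤ J := eulerIntegral_nonneg hθ
  have hG : Measurable fun ν : Measure (Plane × ℝ × S.Mark) =>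
      expNeg (ENNReal.ofReal (S.θ / S.ρ) * ∫⁻ v, S.outContribution z i o v ∂ν) :=
    measurable_expNeg.comp
      ((Measure.measurable_lintegral (measurable_outContribution S z i o)).const_mul _)
  have hinter := lintegral_expNeg_interCell hnn hS hX ho z
  rw [← hJ, lintegral_map (by fun_prop) hnd, lintegral_nearestDist_sq hlam hΨ,
    ← ENNReal.ofReal_mul (by positivity), ← ENNReal.ofReal_mul (by positivity),
    ← ENNReal.ofReal_mul (by positivity), expNeg_ofReal (by positivity)] at hinter
  have hintra := lintegral_expNeg_intraCell_mul hS hX ho hG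
  have hdec : ∀ ω, expNeg (ENNReal.ofReal (S.θ / S.ρ) *
        (X.intraCell i o ω + X.interCell z i o ω + ENNReal.ofReal (S.σ ^ 2))) =
      expNeg (ENNReal.ofReal (S.θ / S.ρ) * X.intraCell i o ω) *
        expNeg (ENNReal.ofReal (S.θ / S.ρ) * X.interCell z i o ω) *
        ENNReal.ofReal (Real.exp (-(S.θ / S.ρ * S.σ ^ 2))) := by
    intro ω
    rw [mul_add, mul_add, expNeg_add, expNeg_add, ← ENNReal.ofReal_mul (by positivity),
      expNeg_ofReal (by positivity)]
  have h1 : (0 : ℝ) ≤ 1 - 1 / (1 + S.θ) := by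
    rw [sub_nonneg]; exact div_le_one_of_le₀ (by linarith) (by linarith)
  rw [Snapshot.coverage, Measure.real, measure_sinr_eq_lintegral hS hX]
  simp_rw [hdec]
  rw [lintegral_mul_const' _ _ ENNReal.ofReal_ne_top]
  -- `X.interCell z i o ω` is by definition a function of the device process `X.devices ω`.
  change (((∫⁻ ω, expNeg (ENNReal.ofReal (S.θ / S.ρ) * X.intraCell i o ω) *
    expNeg (ENNReal.ofReal (S.θ / S.ρ) * ∫⁻ v, S.outContribution z i o v ∂(X.devices ω)) ∂P)) *
      _).toReal = _
  rw [hintra]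
  change ((_ * ∫⁻ ω, expNeg (ENNReal.ofReal (S.θ / S.ρ) * X.interCell z i o ω) ∂P) * _).toReal = _
  rw [hinter, ← ENNReal.ofReal_mul (by positivity), ← ENNReal.ofReal_mul (by positivity),
    ENNReal.toReal_ofReal (by positivity)]
  have hbase : cellConst * S.bsDensity / (cellConst * S.bsDensity +
        S.devDensity * ((1 - 1 / (1 + S.θ)) * (S.ζ π i / S.channels m i))) =
      (1 + S.θ * S.ζ π i * S.κ m i / ((1 + S.θ) * cellConst))⁻¹ := by
    have h2 : 0 < cellConst * S.bsDensity +
        S.devDensity * ((1 - 1 / (1 + S.θ)) * (S.ζ π i / S.channels m i)) := by positivity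
    refine eq_inv_of_mul_eq_one_left ?_
    rw [div_mul_eq_mul_div, div_eq_one_iff_eq h2.ne', Params.κ]
    field_simp
    ring
  have h3 : 0 ≤ 1 + S.θ * S.ζ π i * S.κ m i / ((1 + S.θ) * cellConst) := by
    unfold Params.κ; positivity
  rw [hbase, Real.inv_rpow h3, mul_assoc, ← Real.exp_add, mul_comm, div_eq_mul_inv]
  congr 2
  rw [Params.κ]
  field_simp
  ring

end Coverage

end UplinkIoT

theorem theorem1 {N : ℕ} (S : UplinkIoT.Params N) (hS : S.Valid)
    -- the base stations; a device has the distance `nearestDist (Ψ ω)` to its serving base station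
    {Ω₀ : Type*} [MeasurableSpace Ω₀] (P₀ : MeasureTheory.Measure Ω₀)
    [MeasureTheory.IsProbabilityMeasure P₀]
    (Ψ : Ω₀ → MeasureTheory.Measure UplinkIoT.Plane)
    (hΨ : UplinkIoT.IsPoissonProcess P₀ Ψ
      (ENNReal.ofReal S.bsDensity • (MeasureTheory.volume : MeasureTheory.Measure UplinkIoT.Plane)))
    -- the joint law of the queue lengths of a device
    (π : MeasureTheory.Measure S.QueueState) [MeasureTheory.IsProbabilityMeasure π]
    -- the allocation strategy and the considered priority class
    (m : UplinkIoT.Allocation) (i : Fin N)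
    {Ω : Type*} [MeasurableSpace Ω] (P : MeasureTheory.Measure Ω)
    [MeasureTheory.IsProbabilityMeasure P]
    (X : UplinkIoT.Snapshot S Ω)
    (hX : X.IsNetwork P (P₀.map (fun ω => UplinkIoT.nearestDist (Ψ ω))) π m i)
    -- the location of the serving base station and the channel of the typical device
    (z : UplinkIoT.Plane) (o : ℕ) (ho : o < ⌊S.channels m i⌋₊) :
    X.coverage P z i o =
      Real.exp (-(S.σ ^ 2 * S.θ / S.ρ)
          - 2 * S.θ * S.ζ π i * S.κ m i / (S.η - 2)
            * UplinkIoT.gaussHypergeometric 1 (1 - 2 / S.η) (2 - 2 / S.η) (-S.θ))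
        / (1 + S.θ * S.ζ π i * S.κ m i / ((1 + S.θ) * UplinkIoT.cellConst)) ^ UplinkIoT.cellConst
    ∧ (S.η = 4 →
      X.coverage P z i o =
        Real.exp (-(S.σ ^ 2 * S.θ / S.ρ)
            - S.ζ π i * S.κ m i * Real.sqrt S.θ * Real.arctan (Real.sqrt S.θ))
          / (1 + S.θ * S.ζ π i * S.κ m i / ((1 + S.θ) * UplinkIoT.cellConst))
              ^ UplinkIoT.cellConst) := by
  have hη : 0 < S.η := two_pos.trans hS.two_lt_η
  have hb : 0 < 1 - 2 / S.η := by rw [sub_pos, div_lt_one hη]; exact hS.two_lt_η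
  have hcov := UplinkIoT.coverage_eq hS hΨ hX z ho
  refine ⟨?_, fun h4 => ?_⟩
  · have hη2 : S.η - 2 ≠ 0 := (sub_pos.2 hS.two_lt_η).ne'
    have hθ : -S.θ < 1 := by linarith [hS.θ_pos]
    rw [hcov, show (2 - 2 / S.η : ℝ) = (1 - 2 / S.η) + 1 by ring,
      UplinkIoT.gaussHypergeometric_one_eq_integral hb hθ]
    congr 3
    field_simp
  · have hs : Real.sqrt S.θ ≠ 0 := (Real.sqrt_pos.2 hS.θ_pos).ne'
    have hsq : Real.sqrt S.θ * Real.sqrt S.θ = S.θ := Real.mul_self_sqrt hS.θ_pos.le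
    rw [hcov, h4, show (1 - 2 / 4 : ℝ) = 1 / 2 by norm_num,
      UplinkIoT.integral_inv_sqrt_div_one_add_mul hS.θ_pos]
    congr 3
    nth_rewrite 1 [← hsq]
    field_simp
    ring
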